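/- Let $p$ be a prime number and let $\ell\ge 1$ and $k\ge 1$ be integers. For integers $v\ge 2$ and $k\ge1$, let $N(v,k)$ denote the number of unimodular equivalence classes, counted over all dimensions $d$ together, of $d$-dimensional lattice simplices $\Delta\subset\mathbb R^d$ such that (a) $\Delta$ is Gorenstein, i.e. for some integer $r\ge1$ the dilate $r\Delta$ is unimodularly equivalent to a reflexive polytope (a lattice polytope that contains the origin in its interior and whose dual polytope is again a lattice polytope); (b) $\Delta$ is not a lattice pyramid, i.e. it is not unimodularly equivalent to $\operatorname{conv}\bigl(Q\times\{0\}\cup\{(0,\dots,0,1)\}\bigr)$ for any lattice polytope $Q\subset\mathbb R^{d-1}$; (c) the $h^*$-polynomial of $\Delta$, defined by $h^*(\Delta,t)=(1-t)^{d+1}\bigl(1+\sum_{m\ge1}|m\Delta\cap\mathbb Z^d|\,t^m\bigr)$, is $1+t^k+t^{2k}+\cdots+t^{(v-1)k}$. Here $P,Q\subset\mathbb R^d$ are unimodularly equivalent if $Q=PU+w$ for some $U\in\mathbb Z^{d\times d}$ with $\det U=\pm1$ and some $w\in\mathbb Z^d$. Then $N(p^\ell,k)$ is finite and $$N(p^\ell,k)=\sum_{s=1}^{\ell}\binom{\ell-1}{s-1}\,s!.$$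 -/

import Mathlib

open scoped Pointwise

namespace LatticePolytope

/-- The integer points `ℤ^d` inside `ℝ^d`. -/
def integerPoints (d : ℕ) : Set (Fin d → ℝ) :=
  Set.range fun (z : Fin d → ℤ) (i : Fin d) => (z i : ℝ)

/-- A lattice polytope in `ℝ^d`: the convex hull of a nonempty finite set of integer points. -/
def IsLatticePolytope {d : ℕ} (P : Set (Fin d → ℝ)) : Prop :=
  ∃ V : Set (Fin d → ℝ), V.Finite ∧ V.Nonempty ∧ V ⊆ integerPoints d ∧ P = convexHull ℝ V

/-- A lattice simplex of full dimension `d` in `ℝ^d`: the convex hull of `d + 1` affinely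
independent integer points. -/
def IsLatticeSimplex {d : ℕ} (P : Set (Fin d → ℝ)) : Prop :=
  ∃ v : Fin (d + 1) → Fin d → ℝ, (∀ j, v j ∈ integerPoints d) ∧ AffineIndependent ℝ v ∧
    P = convexHull ℝ (Set.range v)

/-- The affine map `x ↦ x U + w` of `ℝ^d` given by an integer matrix `U` and an integer
vector `w` (vectors are rows). -/
def integerAffineMap {d : ℕ} (U : Matrix (Fin d) (Fin d) ℤ) (w : Fin d → ℤ)
    (x : Fin d → ℝ) : Fin d → ℝ :=
  Matrix.vecMul x (U.map (Int.cast : ℤ → ℝ)) + fun i => (w i : ℝ)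

/-- Unimodular equivalence: `Q = f_U(P) + w` with `U` an integer matrix of determinant `±1`
and `w` an integer vector. -/
def UnimodularlyEquivalent {d : ℕ} (P Q : Set (Fin d → ℝ)) : Prop :=
  ∃ (U : Matrix (Fin d) (Fin d) ℤ) (w : Fin d → ℤ), IsUnit U.det ∧ Q = integerAffineMap U w '' P

/-- The number `L_P(m)` of integer points of the dilate `m P`. -/
noncomputable def latticePointCount {d : ℕ} (P : Set (Fin d → ℝ)) (m : ℕ) : ℕ :=
  (((m : ℝ) • P) ∩ integerPoints d).ncard

/-- The Ehrhart series `1 + ∑_{m ≥ 1} L_P(m) t^m`. -/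
noncomputable def ehrhartSeries {d : ℕ} (P : Set (Fin d → ℝ)) : PowerSeries ℤ :=
  PowerSeries.mk fun m => if m = 0 then 1 else (latticePointCount P m : ℤ)

/-- `h` is the `h^*`-polynomial of the `d`-dimensional polytope `P` in `ℝ^d`, that is,
`h(t) = (1 - t)^(d + 1) * Ehr_P(t)`. -/
def HasHStarPolynomial {d : ℕ} (P : Set (Fin d → ℝ)) (h : Polynomial ℤ) : Prop :=
  (h : PowerSeries ℤ) = (1 - PowerSeries.X) ^ (d + 1) * ehrhartSeries P

/-- The lattice pyramid `conv (Q × {0} ∪ {(0, …, 0, 1)})` in `ℝ^(d + 1)` over `Q` in `ℝ^d`. -/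
def pyramid {d : ℕ} (Q : Set (Fin d → ℝ)) : Set (Fin (d + 1) → ℝ) :=
  convexHull ℝ
    ((fun x : Fin d → ℝ => (Fin.snoc x 0 : Fin (d + 1) → ℝ)) '' Q ∪
      {(Fin.snoc (0 : Fin d → ℝ) 1 : Fin (d + 1) → ℝ)})

/-- `P` is, up to unimodular equivalence, a lattice pyramid over a lattice polytope of one
dimension less. The base may itself be a pyramid, so this covers iterated pyramids. -/
def IsLatticePyramid : {d : ℕ} → Set (Fin d → ℝ) → Prop
  | 0, _ => False
  | d + 1, P => ∃ Q : Set (Fin d → ℝ), IsLatticePolytope Q ∧ UnimodularlyEquivalent (pyramid Q) P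

/-- The dual polytope `{y : ⟨x, y⟩ ≤ 1 for all x ∈ P}`. -/
def dualPolytope {d : ℕ} (P : Set (Fin d → ℝ)) : Set (Fin d → ℝ) :=
  {y | ∀ x ∈ P, x ⬝ᵥ y ≤ 1}

/-- A reflexive polytope: a lattice polytope with the origin in its interior whose dual is
again a lattice polytope. -/
def IsReflexive {d : ℕ} (P : Set (Fin d → ℝ)) : Prop :=
  IsLatticePolytope P ∧ (0 : Fin d → ℝ) ∈ interior P ∧ IsLatticePolytope (dualPolytope P)

/-- `P` is Gorenstein: for some index `r ≥ 1`, the dilate `r P` is unimodularly equivalent to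
a reflexive polytope. -/
def IsGorenstein {d : ℕ} (P : Set (Fin d → ℝ)) : Prop :=
  ∃ r : ℕ, 1 ≤ r ∧ ∃ Q : Set (Fin d → ℝ), IsReflexive Q ∧ UnimodularlyEquivalent ((r : ℝ) • P) Q

/-- The polynomial `1 + t^k + t^(2k) + ⋯ + t^((v - 1)k)`. -/
noncomputable def blockPolynomial (v k : ℕ) : Polynomial ℤ :=
  ∑ i ∈ Finset.range v, Polynomial.X ^ (i * k)

/-- The `d`-dimensional Gorenstein simplices in `ℝ^d` that are not lattice pyramids and whose
`h^*`-polynomial is `1 + t^k + ⋯ + t^((v - 1)k)`. -/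
def GorensteinSimplex (v k d : ℕ) : Type :=
  {P : Set (Fin d → ℝ) // IsLatticeSimplex P ∧ IsGorenstein P ∧ ¬ IsLatticePyramid P ∧
    HasHStarPolynomial P (blockPolynomial v k)}

theorem UnimodularlyEquivalent.refl {d : ℕ} (P : Set (Fin d → ℝ)) :
    UnimodularlyEquivalent P P := by
  refine ⟨1, 0, by simp, ?_⟩
  have h : integerAffineMap (1 : Matrix (Fin d) (Fin d) ℤ) 0 = id := by
    funext x
    ext i
    simp [integerAffineMap]
  rw [h, Set.image_id]

theorem UnimodularlyEquivalent.trans {d : ℕ} {P Q R : Set (Fin d → ℝ)}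
    (h₁ : UnimodularlyEquivalent P Q) (h₂ : UnimodularlyEquivalent Q R) :
    UnimodularlyEquivalent P R := by
  obtain ⟨U, w, hU, rfl⟩ := h₁
  obtain ⟨V, z, hV, rfl⟩ := h₂
  refine ⟨U * V, Matrix.vecMul w V + z, by rw [Matrix.det_mul]; exact hU.mul hV, ?_⟩
  rw [Set.image_image]
  refine Set.image_congr fun x _ => ?_
  have hm : (U * V).map (Int.cast : ℤ → ℝ) = U.map Int.cast * V.map Int.cast :=
    Matrix.map_mul (f := Int.castRingHom ℝ)
  ext i
  simp only [integerAffineMap, hm, Matrix.add_vecMul, Matrix.vecMul_vecMul, Pi.add_apply]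
  rw [add_assoc]
  congr 1
  push_cast
  congr 1
  simp [Matrix.vecMul, dotProduct]

theorem UnimodularlyEquivalent.symm {d : ℕ} {P Q : Set (Fin d → ℝ)}
    (h : UnimodularlyEquivalent P Q) : UnimodularlyEquivalent Q P := by
  obtain ⟨U, w, hU, rfl⟩ := h
  refine ⟨U⁻¹, -Matrix.vecMul w U⁻¹, (Matrix.isUnit_nonsing_inv_det_iff).2 hU, ?_⟩
  rw [Set.image_image]
  have hm : U.map (Int.cast : ℤ → ℝ) * U⁻¹.map Int.cast = 1 := by
    have h1 : (U * U⁻¹).map (Int.castRingHom ℝ) =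
        U.map (Int.cast : ℤ → ℝ) * U⁻¹.map Int.cast :=
      Matrix.map_mul (f := Int.castRingHom ℝ)
    rw [← h1, Matrix.mul_nonsing_inv U hU]
    simp
  have hid : ∀ x, integerAffineMap U⁻¹ (-Matrix.vecMul w U⁻¹) (integerAffineMap U w x) = x := by
    intro x
    ext i
    simp only [integerAffineMap, Matrix.add_vecMul, Matrix.vecMul_vecMul, hm, Pi.add_apply,
      Matrix.vecMul_one]
    simp [Matrix.vecMul, dotProduct]
  simp [hid]

/-- Unimodular equivalence as an equivalence relation on these simplices. -/
def gorensteinSimplexSetoid (v k d : ℕ) : Setoid (GorensteinSimplex v k d) where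
  r P Q := UnimodularlyEquivalent P.1 Q.1
  iseqv := ⟨fun P => .refl P.1, fun h => h.symm, fun h₁ h₂ => h₁.trans h₂⟩

/-- `N(v, k)`: the number, over all dimensions `d`, of unimodular equivalence classes of
Gorenstein simplices that are not lattice pyramids and whose `h^*`-polynomial is
`1 + t^k + ⋯ + t^((v - 1)k)`. Its value is `⊤` if there are infinitely many classes. -/
noncomputable def numClasses (v k : ℕ) : ℕ∞ :=
  ENat.card (Σ d : ℕ, Quotient (gorensteinSimplexSetoid v k d))

end LatticePolytope

/-! A lattice simplex with vertices `v i` is encoded by the group Λ of weight vectors `a` for which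
`∑ a i` and `∑ a i • v i` are integral (`baryLattice`). It contains ℤ^(d+1) and determines the
simplex up to unimodular equivalence. Every group between ℤ^(d+1) and some (1/N)ℤ^(d+1) with
integral coordinate sums arises in this way. In positive dimension, the simplex is a pyramid exactly
when some coordinate is integral on all of Λ. Its h*-polynomial is the sum of t^(∑ a i) over the
elements of Λ in the box [0,1)^(d+1). The condition on h* therefore says that the box heights are 0,
k, …, (v-1)k, each taken once (`hasHStarPolynomial_blockPolynomial_iff`).

Such groups come from weighted forests. Suppose a subgroup Λ₀ has box heights 0, …, (N-1)k with N <
v. Let g be the box element of Λ of height kN and q its order modulo Λ₀. Uniqueness of heights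
forbids carries in a + b g for a in the box of Λ₀ and b < q (`add_nsmul_lt_one`). Applied to the
highest a, this forces q g i to be 0 or 1/m_i, where m_i is the product of the weights from the node
of coordinate i to its root (`IsBalanced.exists_generator`). Adjoining g thus means placing a node
of weight q above some of the current roots (`IsBalanced.exists_extension`). Iterating exhausts Λ,
and heights become numbers written in mixed radix. Conversely, a forest prescribes positive
multiplicities for its labels and so yields a simplex; it is Gorenstein because the vector (1/m_i)
lies in Λ.

The forest can be read off from Λ (`IsBalanced.unique`): multiplying the box element of height k
n_0⋯n_(j-1) by n_j and reducing modulo 1 gives an element whose digits mark the children of j. So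
classes correspond to an ordered factorization of v into s factors together with a parent for each
node. For v = p^l there are C(l-1, s-1) factorizations, and s! parent functions because node j
chooses among j+1, …, s. -/

namespace LatticePolytope

/-! ### Integrality, unit boxes and mixed radix digits. -/

/-- The integers, as a subring of the reals. -/
abbrev intSubring : Subring ℝ := (Int.castRingHom ℝ).range

theorem mem_intSubring {r : ℝ} : r ∈ intSubring ↔ ∃ z : ℤ, (z : ℝ) = r := by
  simp [intSubring]

theorem sub_fract_mem_intSubring (r : ℝ) : r - Int.fract r ∈ intSubring :=
  mem_intSubring.2 ⟨⌊r⌋, by rw [Int.self_sub_fract]⟩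

theorem fract_sub_mem_intSubring (r : ℝ) : Int.fract r - r ∈ intSubring := by
  have := intSubring.neg_mem (sub_fract_mem_intSubring r)
  rwa [neg_sub] at this

theorem eq_zero_of_mem_intSubring {r : ℝ} (h : r ∈ intSubring) (h0 : -1 < r) (h1 : r < 1) :
    r = 0 := by
  obtain ⟨z, rfl⟩ := mem_intSubring.1 h
  have h2 : -1 < z := by exact_mod_cast h0
  have h3 : z < 1 := by exact_mod_cast h1
  have : z = 0 := by omega
  simp [this]

theorem exists_nat_of_mem_intSubring {r : ℝ} (h : r ∈ intSubring) (h0 : -1 < r) :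
    ∃ m : ℕ, (m : ℝ) = r := by
  obtain ⟨z, rfl⟩ := mem_intSubring.1 h
  have h2 : -1 < z := by exact_mod_cast h0
  lift z to ℕ using by omega
  exact ⟨z, by simp⟩

/-- The vectors of a subgroup of `ℝ^ι` whose coordinates lie in `[0, 1)`. -/
def unitBox {ι : Type*} (L : AddSubgroup (ι → ℝ)) : Set (ι → ℝ) :=
  {x | x ∈ L ∧ ∀ i, 0 ≤ x i ∧ x i < 1}

theorem unitBox_ext {ι : Type*} {L L' : AddSubgroup (ι → ℝ)} {x y : ι → ℝ} (hx : x ∈ unitBox L)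
    (hy : y ∈ unitBox L') (h : ∀ i, x i - y i ∈ intSubring) : x = y := by
  funext i
  have := eq_zero_of_mem_intSubring (h i) (by linarith [(hx.2 i).1, (hy.2 i).2])
    (by linarith [(hx.2 i).2, (hy.2 i).1])
  linarith

/-- The coordinate sums over the unit box of `L` are `0, k, …, (v - 1) k`, each taken once. -/
def HasBlockHeights {ι : Type*} [Fintype ι] (L : AddSubgroup (ι → ℝ)) (v k : ℕ) : Prop :=
  (∀ M < v, ∃! x, x ∈ unitBox L ∧ ∑ i, x i = k * M) ∧
    ∀ x ∈ unitBox L, ∃ M < v, ∑ i, x i = k * M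

/-- A forest on `{0, …, s - 1}` in which the parent of `j` is larger than `j`, the value `s`
standing for "no parent", with a weight `n j ≥ 2` at every node. -/
structure IsForest (s : ℕ) (n par : ℕ → ℕ) : Prop where
  two_le : ∀ j < s, 2 ≤ n j
  lt_par : ∀ j < s, j < par j
  par_le : ∀ j < s, par j ≤ s

/-- The place values `n 0 * ⋯ * n (j - 1)` of the mixed radix system with bases `n`. -/
def placeValue (n : ℕ → ℕ) (j : ℕ) : ℕ := ∏ i ∈ Finset.range j, n i

theorem placeValue_zero (n : ℕ → ℕ) : placeValue n 0 = 1 := by simp [placeValue]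

theorem placeValue_succ (n : ℕ → ℕ) (j : ℕ) : placeValue n (j + 1) = placeValue n j * n j := by
  simp [placeValue, Finset.prod_range_succ]

/-- The expression `n j * x j - x (par j)`. -/
def defect (n par : ℕ → ℕ) (x : ℕ → ℝ) (j : ℕ) : ℝ := n j * x j - x (par j)

theorem exists_digits (n : ℕ → ℕ) (s : ℕ) (hn : ∀ j < s, 2 ≤ n j) {M : ℕ}
    (hM : M < placeValue n s) :
    ∃ y : ℕ → ℕ, (∀ j < s, y j < n j) ∧ ∑ j ∈ Finset.range s, placeValue n j * y j = M := by
  induction s generalizing M with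
  | zero => exact ⟨0, by simp, by simp [placeValue] at hM ⊢; omega⟩
  | succ s ih =>
    rw [placeValue_succ] at hM
    have hpos : 0 < placeValue n s := Nat.pos_of_ne_zero fun h0 => by simp [h0] at hM
    obtain ⟨y, hy, hs⟩ := ih (fun j hj => hn j (by omega)) (Nat.mod_lt M hpos)
    refine ⟨Function.update y s (M / placeValue n s), fun j hj => ?_, ?_⟩
    · rcases Nat.lt_succ_iff_lt_or_eq.1 hj with h | rfl
      · rw [Function.update_of_ne h.ne]; exact hy j h
      · rw [Function.update_self]; exact Nat.div_lt_of_lt_mul hM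
    · rw [Finset.sum_range_succ, Function.update_self]
      have : ∑ j ∈ Finset.range s, placeValue n j * Function.update y s (M / placeValue n s) j =
          ∑ j ∈ Finset.range s, placeValue n j * y j :=
        Finset.sum_congr rfl fun j hj => by
          rw [Function.update_of_ne (Finset.mem_range.1 hj).ne]
      rw [this, hs, Nat.mod_add_div]

theorem sum_digits_lt (n : ℕ → ℕ) (s : ℕ) (y : ℕ → ℕ) (hy : ∀ j < s, y j < n j) :
    ∑ j ∈ Finset.range s, placeValue n j * y j < placeValue n s := by
  induction s with
  | zero => simp [placeValue]
  | succ s ih =>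
    rw [Finset.sum_range_succ, placeValue_succ]
    have h1 := ih fun j hj => hy j (by omega)
    have h2 := Nat.mul_le_mul_left (placeValue n s) (hy s (by omega))
    rw [Nat.succ_eq_add_one, mul_add] at h2
    omega

theorem digits_unique (n : ℕ → ℕ) (s : ℕ) (y z : ℕ → ℕ) (hy : ∀ j < s, y j < n j)
    (hz : ∀ j < s, z j < n j)
    (h : ∑ j ∈ Finset.range s, placeValue n j * y j = ∑ j ∈ Finset.range s, placeValue n j * z j) :
    ∀ j < s, y j = z j := by
  induction s with
  | zero => simp
  | succ s ih =>
    rw [Finset.sum_range_succ, Finset.sum_range_succ] at h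
    have h1 := sum_digits_lt n s y fun j hj => hy j (by omega)
    have h2 := sum_digits_lt n s z fun j hj => hz j (by omega)
    have hpos : 0 < placeValue n s := by omega
    have e1 : y s = z s := by
      have := congrArg (· / placeValue n s) h
      simpa [Nat.add_mul_div_left _ _ hpos, Nat.div_eq_of_lt h1, Nat.div_eq_of_lt h2] using this
    rw [e1] at h
    intro j hj
    rcases Nat.lt_succ_iff_lt_or_eq.1 hj with hj | rfl
    · exact ih (fun j hj => hy j (by omega)) (fun j hj => hz j (by omega)) (by omega) j hj
    · exact e1

/-! ### Solving the congruences along a forest. -/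

namespace IsForest

variable {s : ℕ} {n par : ℕ → ℕ}

/-- Parents have larger numbers than their children, so induction on `s - j` runs from the roots to
the leaves. -/
theorem rec_down (h : IsForest s n par) {P : ℕ → Prop} (hs : P s)
    (step : ∀ j < s, P (par j) → P j) : ∀ j ≤ s, P j := by
  have key : ∀ t j, j ≤ s → s - j ≤ t → P j := by
    intro t
    induction t with
    | zero => intro j h1 h2; rwa [show j = s by omega]
    | succ t ih =>
      intro j h1 h2
      rcases h1.lt_or_eq with h3 | rfl
      · have := h.lt_par j h3
        exact step j h3 (ih _ (h.par_le j h3) (by omega))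
      · exact hs
  exact fun j hj => key _ j hj le_rfl

/-- Values are filled in for the nodes `s - 1`, `s - 2`, … in turn; updating a node never disturbs
an equation already settled, since those involve larger indices only. -/
theorem exists_rec (h : IsForest s n par) {α : Type*} (f : ℕ → α → α) (a : α) :
    ∃ x : ℕ → α, x s = a ∧ ∀ j < s, x j = f j (x (par j)) := by
  have key : ∀ t ≤ s, ∃ x : ℕ → α, x s = a ∧ ∀ j < s, s - t ≤ j → x j = f j (x (par j)) := by
    intro t
    induction t with
    | zero => exact fun _ => ⟨fun _ => a, rfl, fun j h1 h2 => by omega⟩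
    | succ t ih =>
      intro ht
      obtain ⟨x, hx, hx'⟩ := ih (by omega)
      refine ⟨Function.update x (s - (t + 1))
        (f (s - (t + 1)) (x (par (s - (t + 1))))), ?_, fun j h1 h2 => ?_⟩
      · rw [Function.update_of_ne (by omega), hx]
      · have hp := h.lt_par j h1
        rw [Function.update_of_ne (by omega : par j ≠ _)]
        rcases h2.lt_or_eq with h3 | h3
        · rw [Function.update_of_ne (by omega)]
          exact hx' j h1 (by omega)
        · subst h3
          rw [Function.update_self]
  obtain ⟨x, h0, h1⟩ := key s le_rfl
  exact ⟨x, h0, fun j hj => h1 j hj (by omega)⟩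

theorem exists_defect_eq (h : IsForest s n par) (y : ℕ → ℝ) :
    ∃ x : ℕ → ℝ, x s = 0 ∧ ∀ j < s, defect n par x j = y j := by
  obtain ⟨x, h0, h1⟩ := h.exists_rec (fun j t => (y j + t) / n j) 0
  refine ⟨x, h0, fun j hj => ?_⟩
  have hn := h.two_le j hj
  have : (n j : ℝ) ≠ 0 := by positivity
  rw [defect, h1 j hj]
  field_simp
  ring

/-- The product of the weights on the path from a node to its root. -/
theorem exists_degree (h : IsForest s n par) : ∃ m : ℕ → ℕ, m s = 1 ∧
    (∀ j < s, m j = n j * m (par j)) ∧ (∀ j ≤ s, 1 ≤ m j) ∧ (∀ j < s, 2 ≤ m j) ∧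
    ∀ x : ℕ → ℝ, x s = 0 → (∀ j < s, defect n par x j ∈ intSubring) →
      ∀ j ≤ s, m j * x j ∈ intSubring := by
  obtain ⟨m, h0, h1⟩ := h.exists_rec (fun j t => n j * t) 1
  have hpos : ∀ j ≤ s, 1 ≤ m j := h.rec_down h0.ge fun j hj hp => by
    rw [h1 j hj]
    have := h.two_le j hj
    nlinarith
  refine ⟨m, h0, h1, hpos, fun j hj => ?_, fun x hx hd => h.rec_down (by simp [hx]) ?_⟩
  · have := h.two_le j hj
    have := hpos _ (h.par_le j hj)
    rw [h1 j hj]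
    nlinarith
  · intro j hj hp
    have := intSubring.add_mem (intSubring.mul_mem (natCast_mem intSubring (m (par j))) (hd j hj)) hp
    rw [h1 j hj]
    convert this using 1
    unfold defect
    push_cast
    ring

theorem eq_of_defect_eq (h : IsForest s n par) {x x' : ℕ → ℝ} (h0 : x s = x' s)
    (h1 : ∀ j < s, defect n par x j = defect n par x' j) : ∀ j ≤ s, x j = x' j := by
  refine h.rec_down h0 fun j hj hp => ?_
  have := h1 j hj
  unfold defect at this
  have hn := h.two_le j hj
  have hn' : (n j : ℝ) ≠ 0 := by positivity
  exact mul_left_cancel₀ hn' (by linarith)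

/-- For `x` in `[0, 1)` the defect at `j` lies strictly between `-1` and `n j`, so an integral
defect is a digit in base `n j`. -/
theorem exists_digit_of_mem_Ico (h : IsForest s n par) {x : ℕ → ℝ}
    (hx : ∀ j ≤ s, 0 ≤ x j ∧ x j < 1) (hd : ∀ j < s, defect n par x j ∈ intSubring) :
    ∃ y : ℕ → ℕ, ∀ j < s, y j < n j ∧ defect n par x j = y j := by
  have : ∀ j, ∃ m : ℕ, j < s → m < n j ∧ defect n par x j = m := by
    intro j
    by_cases hj : j < s
    · have h1 := hx j hj.le
      have h2 := hx _ (h.par_le j hj)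
      have hn := h.two_le j hj
      have hn' : (0 : ℝ) < n j := by positivity
      obtain ⟨m, hm⟩ := exists_nat_of_mem_intSubring (hd j hj) (by
        unfold defect; nlinarith)
      refine ⟨m, fun _ => ⟨?_, hm.symm⟩⟩
      have : (m : ℝ) < n j := by rw [hm]; unfold defect; nlinarith
      exact_mod_cast this
    · exact ⟨0, fun h => absurd h hj⟩
  choose y hy using this
  exact ⟨y, hy⟩

/-- Going down from the roots, `n j * x j` is at most `n j - 1` plus a number less than `1`. -/
theorem mem_Ico_of_digit (h : IsForest s n par) {x : ℕ → ℝ} {y : ℕ → ℕ} (hs : x s = 0)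
    (hy : ∀ j < s, y j < n j ∧ defect n par x j = y j) : ∀ j ≤ s, 0 ≤ x j ∧ x j < 1 := by
  refine h.rec_down (by simp [hs]) fun j hj hp => ?_
  obtain ⟨h1, h2⟩ := hy j hj
  have h3 : (y j : ℝ) + 1 ≤ n j := by exact_mod_cast h1
  have hn := h.two_le j hj
  have hn' : (0 : ℝ) < n j := by positivity
  unfold defect at h2
  have h4 : (0 : ℝ) ≤ y j := by positivity
  have e : (n j : ℝ) * x j = y j + x (par j) := by linarith
  constructor
  · exact nonneg_of_mul_nonneg_right (by linarith [hp.1] : 0 ≤ (n j : ℝ) * x j) hn'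
  · exact lt_of_mul_lt_mul_left (by linarith [hp.2] : (n j : ℝ) * x j < n j * 1) hn'.le

theorem placeValue_pos (h : IsForest s n par) {j : ℕ} (hj : j ≤ s) : 0 < placeValue n j :=
  Finset.prod_pos fun i hi => by have := h.two_le i (by simp at hi; omega); omega

end IsForest

theorem defect_sub (n par : ℕ → ℕ) (x y : ℕ → ℝ) (j : ℕ) :
    defect n par (x - y) j = defect n par x j - defect n par y j := by
  simp only [defect, Pi.sub_apply]; ring

theorem defect_add (n par : ℕ → ℕ) (x y : ℕ → ℝ) (j : ℕ) :
    defect n par (x + y) j = defect n par x j + defect n par y j := by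
  simp only [defect, Pi.add_apply]; ring

theorem defect_smul (n par : ℕ → ℕ) (c : ℝ) (x : ℕ → ℝ) (j : ℕ) :
    defect n par (c • x) j = c * defect n par x j := by
  simp only [defect, Pi.smul_apply, smul_eq_mul]; ring

/-! ### Forest lattices and balanced labellings. -/

/-- The vectors congruent modulo `ℤ^ι` to `i ↦ x (e i)`, where `x s = 0` and
`n j * x j ≡ x (par j)` modulo `ℤ` at all nodes `j`. -/
def forestLattice {ι : Type*} (s : ℕ) (n par : ℕ → ℕ) (e : ι → ℕ) : AddSubgroup (ι → ℝ) where
  carrier := {a | ∃ x : ℕ → ℝ, x s = 0 ∧ (∀ j < s, defect n par x j ∈ intSubring) ∧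
    ∀ i, a i - x (e i) ∈ intSubring}
  zero_mem' := ⟨0, rfl, fun j _ => by simp [defect], fun i => by simp⟩
  add_mem' := by
    rintro a b ⟨x, h1, h2, h3⟩ ⟨y, h4, h5, h6⟩
    refine ⟨x + y, by simp [h1, h4], fun j hj => ?_, fun i => ?_⟩
    · rw [defect_add]; exact intSubring.add_mem (h2 j hj) (h5 j hj)
    · have := intSubring.add_mem (h3 i) (h6 i)
      simp only [Pi.add_apply]
      convert this using 1
      ring
  neg_mem' := by
    rintro a ⟨x, h1, h2, h3⟩
    refine ⟨(-1 : ℝ) • x, by simp [h1], fun j hj => ?_, fun i => ?_⟩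
    · rw [defect_smul]
      simpa using intSubring.neg_mem (h2 j hj)
    · have := intSubring.neg_mem (h3 i)
      simp only [Pi.neg_apply, Pi.smul_apply, smul_eq_mul]
      convert this using 1
      ring

theorem mem_forestLattice {ι : Type*} {s : ℕ} {n par : ℕ → ℕ} {e : ι → ℕ} {a : ι → ℝ} :
    a ∈ forestLattice s n par e ↔ ∃ x : ℕ → ℝ, x s = 0 ∧
      (∀ j < s, defect n par x j ∈ intSubring) ∧ ∀ i, a i - x (e i) ∈ intSubring := Iff.rfl

/-- A labelling `e : ι → {0, …, s}` by the nodes of a weighted forest (`s` for "no node") in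
which the multiplicities of the labels are such that the coordinate sum of `x ∘ e` is
`k` times the number with digits `n j * x j - x (par j)`. -/
structure IsBalanced {ι : Type*} [Fintype ι] (s : ℕ) (n par : ℕ → ℕ) (e : ι → ℕ) (k : ℕ) :
    Prop where
  forest : IsForest s n par
  label_le : ∀ i, e i ≤ s
  sum_eq : ∀ x : ℕ → ℝ, x s = 0 →
    ∑ i, x (e i) = k * ∑ j ∈ Finset.range s, placeValue n j * defect n par x j

namespace IsBalanced

variable {ι : Type*} [Fintype ι] {s k : ℕ} {n par : ℕ → ℕ} {e : ι → ℕ}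

/-- Taking fractional parts preserves the congruences, and a box vector congruent to the reduced
solution is equal to it. -/
theorem exists_digits_of_mem_unitBox (h : IsBalanced s n par e k) {a : ι → ℝ}
    (ha : a ∈ unitBox (forestLattice s n par e)) :
    ∃ (x : ℕ → ℝ) (y : ℕ → ℕ), x s = 0 ∧ (∀ j < s, y j < n j ∧ defect n par x j = y j) ∧
      (∀ i, a i = x (e i)) ∧
      ∑ i, a i = k * ((∑ j ∈ Finset.range s, placeValue n j * y j : ℕ) : ℝ) := by
  obtain ⟨⟨x, h0, h1, h2⟩, hb⟩ := ha
  obtain ⟨y, hy⟩ := h.forest.exists_digit_of_mem_Ico (x := fun j => Int.fract (x j))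
    (fun j _ => ⟨Int.fract_nonneg _, Int.fract_lt_one _⟩) (fun j hj => by
      have := intSubring.add_mem (h1 j hj) (intSubring.sub_mem
        (intSubring.mul_mem (natCast_mem intSubring (n j)) (fract_sub_mem_intSubring (x j)))
        (fract_sub_mem_intSubring (x (par j))))
      convert this using 1
      unfold defect
      ring)
  have hax : ∀ i, a i = Int.fract (x (e i)) := fun i => by
    have := eq_zero_of_mem_intSubring (r := a i - Int.fract (x (e i)))
      (by convert intSubring.add_mem (h2 i) (sub_fract_mem_intSubring (x (e i))) using 1; ring)
      (by linarith [(hb i).1, Int.fract_lt_one (x (e i))])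
      (by linarith [(hb i).2, Int.fract_nonneg (x (e i))])
    linarith
  refine ⟨fun j => Int.fract (x j), y, by simp [h0], hy, hax, ?_⟩
  have := h.sum_eq (fun j => Int.fract (x j)) (by simp [h0])
  simp only [hax, this]
  congr 1
  push_cast
  exact Finset.sum_congr rfl fun j hj => by rw [(hy j (Finset.mem_range.1 hj)).2]

theorem mem_unitBox_of_digits (h : IsBalanced s n par e k) {x : ℕ → ℝ} {y : ℕ → ℕ}
    (h0 : x s = 0) (hy : ∀ j < s, y j < n j ∧ defect n par x j = y j) :
    (fun i => x (e i)) ∈ unitBox (forestLattice s n par e) ∧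
      ∑ i, x (e i) = k * ((∑ j ∈ Finset.range s, placeValue n j * y j : ℕ) : ℝ) := by
  refine ⟨⟨⟨x, h0, fun j hj => ?_, fun i => by simp⟩, fun i => ?_⟩, ?_⟩
  · rw [(hy j hj).2]; exact natCast_mem _ _
  · exact h.forest.mem_Ico_of_digit h0 hy _ (h.label_le i)
  · rw [h.sum_eq x h0]
    push_cast
    congr 1
    exact Finset.sum_congr rfl fun j hj => by rw [(hy j (Finset.mem_range.1 hj)).2]

/-- The balance identity is tested on the indicator of node `j`, whose defect is `n j` at `j`, `-1`
at each child of `j` and `0` elsewhere. -/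
theorem card_label (h : IsBalanced s n par e k) {j : ℕ} (hj : j < s) :
    (Finset.univ.filter fun i => e i = j).card +
      k * ∑ c ∈ Finset.range s with par c = j, placeValue n c = k * placeValue n (j + 1) := by
  have := h.sum_eq (Pi.single j 1) (by rw [Pi.single_eq_of_ne (by omega)])
  have e1 : ∑ i, (Pi.single j 1 : ℕ → ℝ) (e i) =
      (Finset.univ.filter fun i => e i = j).card := by
    simp [Pi.single_apply]
  have e2 : ∑ c ∈ Finset.range s, (placeValue n c : ℝ) * defect n par (Pi.single j 1) c =
      placeValue n j * n j - ∑ c ∈ Finset.range s with par c = j, (placeValue n c : ℝ) := by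
    simp only [defect, mul_sub, Finset.sum_sub_distrib, Pi.single_apply, mul_ite, mul_one, mul_zero,
      Finset.sum_ite_eq', Finset.mem_range, hj, if_true, Finset.sum_filter]
  rw [e1, e2] at this
  rw [placeValue_succ]
  have h2 : ((Finset.univ.filter fun i => e i = j).card : ℝ) +
      k * ∑ c ∈ Finset.range s with par c = j, (placeValue n c : ℝ) =
        k * (placeValue n j * n j) := by
    rw [this]; ring
  exact_mod_cast h2

/-- Children of `j` are numbered below `j`, and the sum of all place values below `j` is the number
with every digit `1`. -/
theorem sum_children_lt (h : IsForest s n par) {j : ℕ} (hj : j < s) :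
    ∑ c ∈ Finset.range s with par c = j, placeValue n c < placeValue n j := by
  refine lt_of_le_of_lt (Finset.sum_le_sum_of_subset (t := Finset.range j) fun c hc => ?_) ?_
  · simp only [Finset.mem_filter, Finset.mem_range] at hc ⊢
    rw [← hc.2]
    exact h.lt_par c hc.1
  · simpa using sum_digits_lt n j (fun _ => 1) fun i hi => h.two_le i (by omega)

/-- By `card_label` the multiplicity is `k` times a difference that is positive by
`sum_children_lt`. Hence a condition on coordinates can be read as a condition at every node. -/
theorem exists_label_eq (h : IsBalanced s n par e k) (hk : 1 ≤ k) {j : ℕ} (hj : j < s) :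
    ∃ i, e i = j := by
  by_contra! hne
  have h1 := h.card_label hj
  have h2 := sum_children_lt h.forest hj
  rw [Finset.filter_false_of_mem (by simpa using hne), Finset.card_empty, zero_add] at h1
  have h3 := Nat.eq_of_mul_eq_mul_left (by omega) h1
  rw [placeValue_succ] at h3
  have := h.forest.two_le j hj
  nlinarith

/-- Box elements correspond to digit strings, and the height is `k` times the number so written;
mixed radix expansion is a bijection. -/
theorem hasBlockHeights (h : IsBalanced s n par e k) (hk : 1 ≤ k) :
    HasBlockHeights (forestLattice s n par e) (placeValue n s) k := by
  refine ⟨fun M hM => ?_, fun a ha => ?_⟩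
  · obtain ⟨y, hy, hs⟩ := exists_digits n s h.forest.two_le hM
    obtain ⟨x, h0, hx⟩ := h.forest.exists_defect_eq fun j => (y j : ℝ)
    obtain ⟨h1, h2⟩ := h.mem_unitBox_of_digits h0 fun j hj => ⟨hy j hj, hx j hj⟩
    refine ⟨_, ⟨h1, by rw [h2, hs]⟩, ?_⟩
    rintro b ⟨hb, hbs⟩
    obtain ⟨x', y', h0', hy', hb', hs'⟩ := h.exists_digits_of_mem_unitBox hb
    rw [hbs] at hs'
    have hk' : (k : ℝ) ≠ 0 := by positivity
    have hM' : M = ∑ j ∈ Finset.range s, placeValue n j * y' j := by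
      exact_mod_cast mul_left_cancel₀ hk' hs'
    have hyy := digits_unique n s y' y (fun j hj => (hy' j hj).1) hy (by rw [hs, ← hM'])
    funext i
    rw [hb' i]
    refine h.forest.eq_of_defect_eq (by rw [h0, h0']) (fun j hj => ?_) _ (h.label_le i)
    rw [(hy' j hj).2, hx j hj, hyy j hj]
  · obtain ⟨x, y, h0, hy, -, hs⟩ := h.exists_digits_of_mem_unitBox ha
    exact ⟨_, sum_digits_lt n s y fun j hj => (hy j hj).1, hs⟩

end IsBalanced

end LatticePolytope

/-! ### Growing a forest inside a lattice with block heights. -/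

namespace LatticePolytope

theorem nsmul_pi_apply {ι : Type*} (b : ℕ) (g : ι → ℝ) (i : ι) : (b • g) i = b * g i := by
  simp

theorem intSubring_mem_forestLattice {ι : Type*} {s : ℕ} {n par : ℕ → ℕ} {e : ι → ℕ} {a : ι → ℝ}
    (ha : ∀ i, a i ∈ intSubring) : a ∈ forestLattice s n par e :=
  ⟨0, rfl, fun j _ => by simp [defect], fun i => by simpa using ha i⟩

theorem fract_mem_unitBox {ι : Type*} {L : AddSubgroup (ι → ℝ)}
    (hZ : ∀ a : ι → ℝ, (∀ i, a i ∈ intSubring) → a ∈ L)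
    {a : ι → ℝ} (ha : a ∈ L) : (fun i => Int.fract (a i)) ∈ unitBox L := by
  refine ⟨?_, fun i => ⟨Int.fract_nonneg _, Int.fract_lt_one _⟩⟩
  have := L.add_mem ha (hZ (fun i => Int.fract (a i) - a i) fun i => fract_sub_mem_intSubring _)
  convert this using 1
  funext i
  simp only [Pi.add_apply]
  ring

variable {ι : Type*} [Fintype ι]

/-- Adding to the box elements of `L₀` multiples of `g` produces no carries. -/
theorem add_nsmul_lt_one {L L₀ : AddSubgroup (ι → ℝ)} {v N k q : ℕ} (hk : 1 ≤ k) (hle : L₀ ≤ L)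
    (hZ : ∀ a : ι → ℝ, (∀ i, a i ∈ intSubring) → a ∈ L₀) (hL : HasBlockHeights L v k)
    (hL₀ : HasBlockHeights L₀ N k) {g : ι → ℝ} (hg : g ∈ unitBox L) (hgs : ∑ i, g i = k * N)
    (hq : ∀ b : ℕ, 0 < b → b < q → b • g ∉ L₀) :
    ∀ M : ℕ, ∀ b < q, ∀ a ∈ unitBox L₀, ∀ m < N, ∑ i, a i = k * m → m + b * N = M →
      ∀ i, a i + b * g i < 1 := by
  have hk' : (0 : ℝ) < k := by positivity
  intro M
  induction M using Nat.strong_induction_on with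
  | _ M ih =>
  intro b hb a ha m hm has hM
  have hFL : (a + b • g) ∈ L := L.add_mem (hle ha.1) (L.nsmul_mem hg.1 b)
  have hF0 : ∀ i, 0 ≤ (a + b • g) i := fun i => by
    have := (hg.2 i).1
    have := (ha.2 i).1
    simp only [Pi.add_apply, nsmul_pi_apply]
    positivity
  have hFs : ∑ i, (a + b • g) i = k * M := by
    simp only [Pi.add_apply, nsmul_pi_apply, Finset.sum_add_distrib, has,
      ← Finset.mul_sum, hgs, ← hM]
    push_cast
    ring
  -- Reduction modulo `1` can only lower the height. If the height is unchanged there was no carry;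
  -- a drop to `M' < M` is to be contradicted.
  have hf := fract_mem_unitBox (fun a h => hle (hZ a h)) hFL
  obtain ⟨M', hM'v, hM's⟩ := hL.2 _ hf
  have hfle : ∀ i, Int.fract ((a + b • g) i) ≤ (a + b • g) i := fun i => by
    have : (0 : ℝ) ≤ ⌊(a + b • g) i⌋ := by exact_mod_cast Int.floor_nonneg.2 (hF0 i)
    have := Int.floor_add_fract ((a + b • g) i)
    linarith
  have hM'M : M' ≤ M := by
    have : (k : ℝ) * M' ≤ k * M := by
      rw [← hM's, ← hFs]; exact Finset.sum_le_sum fun i _ => hfle i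
    exact_mod_cast le_of_mul_le_mul_left this hk'
  rcases hM'M.eq_or_lt with rfl | hlt
  · have := (Finset.sum_eq_sum_iff_of_le fun i _ => hfle i).1 (hM's.trans hFs.symm)
    intro i
    have h1 := this i (Finset.mem_univ i)
    have h2 := Int.fract_lt_one ((a + b • g) i)
    rw [h1] at h2
    simpa using h2
  · exfalso
    have hN : 0 < N := by omega
    have hMq : M < q * N := by
      have := Nat.mul_le_mul_right N hb
      rw [Nat.succ_mul] at this
      omega
    have hb' : M' / N < q := (Nat.div_lt_iff_lt_mul hN).2 (by omega)
    obtain ⟨a', ⟨ha', has'⟩, -⟩ := hL₀.1 _ (Nat.mod_lt M' hN)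
    -- By induction the sum built from the quotient and remainder of `M'` by `N` is itself a box
    -- element. It has the same height as the reduced vector, so the two coincide.
    have hlt1 := ih M' hlt _ hb' a' ha' _ (Nat.mod_lt M' hN) has' (Nat.mod_add_div' M' N)
    have hF' : (a' + (M' / N) • g) ∈ unitBox L := by
      refine ⟨L.add_mem (hle ha'.1) (L.nsmul_mem hg.1 _), fun i => ⟨?_, by simpa using hlt1 i⟩⟩
      have := (hg.2 i).1
      have := (ha'.2 i).1
      simp only [Pi.add_apply, nsmul_pi_apply]
      positivity
    have hF's : ∑ i, (a' + (M' / N) • g) i = k * M' := by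
      simp only [Pi.add_apply, nsmul_pi_apply, Finset.sum_add_distrib, has',
        ← Finset.mul_sum, hgs]
      have : (M' : ℝ) = (M' % N : ℕ) + (M' / N : ℕ) * N := by
        exact_mod_cast (Nat.mod_add_div' M' N).symm
      rw [this]; ring
    have heq := (hL.1 M' hM'v).unique ⟨hf, hM's⟩ ⟨hF', hF's⟩
    have hint : ∀ i, (a + b • g) i - (a' + (M' / N) • g) i ∈ intSubring := fun i => by
      rw [← heq]; exact sub_fract_mem_intSubring _
    have hbb : M' / N ≤ b := by
      have h1 : M' / N ≤ M / N := Nat.div_le_div_right hlt.le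
      have h2 : M / N = b := by
        rw [← hM, Nat.add_mul_div_right _ _ hN, Nat.div_eq_of_lt hm, zero_add]
      omega
    -- Minimality of `q` now gives `b = M' / N`; then the two elements of `L₀` agree as well, and `M
    -- = M'`.
    have hmem : (b - M' / N) • g ∈ L₀ := by
      have := L₀.add_mem (hZ (a + b • g - (a' + (M' / N) • g)) hint) (L₀.sub_mem ha'.1 ha.1)
      convert this using 1
      funext i
      simp only [Pi.add_apply, Pi.sub_apply, nsmul_pi_apply, Nat.cast_sub hbb]
      ring
    have hbe : b = M' / N := by
      by_contra hne
      exact hq _ (Nat.sub_pos_of_lt (lt_of_le_of_ne hbb (Ne.symm hne)))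
        ((Nat.sub_le _ _).trans_lt hb) hmem
    have haa : a = a' := unitBox_ext ha ha' fun i => by
      have := hint i
      rw [← hbe] at this
      simpa using this
    rw [haa, has'] at has
    have hmm : M' % N = m := by exact_mod_cast mul_left_cancel₀ hk'.ne' has
    have := Nat.mod_add_div' M' N
    rw [hmm, ← hbe] at this
    omega

/-- The box has only `v` elements, so two distinct multiples of `g` agree modulo integers. -/
theorem exists_pos_nsmul_mem {L L₀ : AddSubgroup (ι → ℝ)} {v k : ℕ} (hle : L₀ ≤ L)
    (hZ : ∀ a : ι → ℝ, (∀ i, a i ∈ intSubring) → a ∈ L₀) (hL : HasBlockHeights L v k)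
    {g : ι → ℝ} (hg : g ∈ L) : ∃ q : ℕ, 0 < q ∧ q • g ∈ L₀ := by
  have hb : ∀ q : ℕ, (fun i => Int.fract ((q • g) i)) ∈ unitBox L := fun q =>
    fract_mem_unitBox (fun a h => hle (hZ a h)) (L.nsmul_mem hg q)
  choose M hMv hMs using fun q : ℕ => hL.2 _ (hb q)
  obtain ⟨q₁, q₂, hne, heq⟩ := Finite.exists_ne_map_eq_of_infinite
    fun q : ℕ => (⟨M q, hMv q⟩ : Fin v)
  have hMM : M q₁ = M q₂ := by simpa using heq
  wlog hlt : q₁ < q₂ generalizing q₁ q₂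
  · exact this q₂ q₁ hne.symm heq.symm hMM.symm (by omega)
  refine ⟨q₂ - q₁, by omega, hZ _ fun i => ?_⟩
  have h1 := (hL.1 _ (hMv q₁)).unique ⟨hb q₁, hMs q₁⟩ ⟨hb q₂, by rw [hMs q₂, hMM]⟩
  have h2 := congrFun h1 i
  have := intSubring.sub_mem (sub_fract_mem_intSubring ((q₂ • g) i))
    (sub_fract_mem_intSubring ((q₁ • g) i))
  rw [h2] at this
  convert this using 1
  simp only [nsmul_pi_apply, Nat.cast_sub hlt.le]
  ring

namespace IsBalanced

variable {s k v : ℕ} {n par : ℕ → ℕ} {e : ι → ℕ}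

/-- The coordinates of the next generator: `g i = 0` or `g i = 1 / (q * m (e i))`. -/
theorem exists_generator (h : IsBalanced s n par e k) (hk : 1 ≤ k) {L : AddSubgroup (ι → ℝ)}
    (hL : HasBlockHeights L v k) (hle : forestLattice s n par e ≤ L) (hlt : placeValue n s < v)
    {m : ℕ → ℕ} (hm0 : m s = 1) (hm : ∀ j < s, m j = n j * m (par j)) (hm1 : ∀ j ≤ s, 1 ≤ m j)
    (hmx : ∀ x : ℕ → ℝ, x s = 0 → (∀ j < s, defect n par x j ∈ intSubring) →
      ∀ j ≤ s, m j * x j ∈ intSubring) :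
    ∃ (g : ι → ℝ) (q : ℕ), g ∈ L ∧ ∑ i, g i = k * placeValue n s ∧ 2 ≤ q ∧
      q • g ∈ forestLattice s n par e ∧ ∀ i, q * g i = 0 ∨ q * g i = 1 / m (e i) := by
  classical
  obtain ⟨g, ⟨hg, hgs⟩, -⟩ := hL.1 _ hlt
  have hL₀ := h.hasBlockHeights hk
  have hZ : ∀ a : ι → ℝ, (∀ i, a i ∈ intSubring) → a ∈ forestLattice s n par e :=
    fun a => intSubring_mem_forestLattice
  have hex := exists_pos_nsmul_mem hle hZ hL hg.1
  have hq0 := (Nat.find_spec hex).1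
  have hqmem := (Nat.find_spec hex).2
  have hqmin : ∀ b : ℕ, 0 < b → b < Nat.find hex → b • g ∉ forestLattice s n par e :=
    fun b hb hbq hmem => Nat.find_min hex hbq ⟨hb, hmem⟩
  generalize Nat.find hex = q at hq0 hqmem hqmin
  -- For `q = 1` the vector `g` would be a box element of the forest lattice, whose heights stay
  -- below `k * placeValue n s`.
  have hq2 : 2 ≤ q := by
    by_contra! hq
    have hq1 : q = 1 := by omega
    rw [hq1, one_smul] at hqmem
    obtain ⟨M, hM, hMs⟩ := hL₀.2 g ⟨hqmem, hg.2⟩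
    rw [hgs] at hMs
    have hk' : (k : ℝ) ≠ 0 := by positivity
    have : placeValue n s = M := by exact_mod_cast mul_left_cancel₀ hk' hMs
    omega
  refine ⟨g, q, hg.1, hgs, hq2, hqmem, fun i => ?_⟩
  have hmne : ∀ j ≤ s, (m j : ℝ) ≠ 0 := fun j hj => by have := hm1 j hj; positivity
  -- This is the highest box element: all digits are maximal, and its coordinates are `1 - 1 / m`.
  -- Adding `(q - 1) • g` to it without carry gives `(q - 1) * g i < 1 / m (e i)`.
  obtain ⟨hbox, hsum⟩ := h.mem_unitBox_of_digits (x := fun j => 1 - 1 / m j)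
    (y := fun j => n j - 1) (by simp [hm0]) (fun j hj => by
      have hn := h.forest.two_le j hj
      refine ⟨by omega, ?_⟩
      have := hmne _ (h.forest.par_le j hj)
      have hn' : (n j : ℝ) ≠ 0 := by positivity
      rw [defect, hm j hj, Nat.cast_sub (by omega)]
      push_cast
      field_simp
      ring)
  have hcarry := add_nsmul_lt_one hk hle hZ hL hL₀ hg hgs hqmin _ (q - 1) (by omega) _ hbox _
    (sum_digits_lt n s _ fun j hj => by have := h.forest.two_le j hj; omega) hsum rfl i
  obtain ⟨x, hx0, hxd, hxi⟩ := hqmem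
  have hint : (m (e i) : ℝ) * (q * g i) ∈ intSubring := by
    have := intSubring.add_mem (intSubring.mul_mem (natCast_mem intSubring (m (e i))) (hxi i))
      (hmx x hx0 hxd _ (h.label_le i))
    convert this using 1
    simp only [nsmul_pi_apply]
    ring
  have hg0 := (hg.2 i).1
  obtain ⟨t, ht⟩ := exists_nat_of_mem_intSubring hint (by
    have : (0 : ℝ) ≤ (m (e i) : ℝ) * (q * g i) := by positivity
    linarith)
  have hmp : (0 : ℝ) < m (e i) := by have := hm1 _ (h.label_le i); positivity
  have hqp : (0 : ℝ) < q := by positivity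
  -- With `t = m * q * g i` the bound reads `(q - 1) * t < q`, which fails for `t ≥ 2` because `q ≥
  -- 2`.
  have ht2 : t < 2 := by
    by_contra! ht2
    have ht2' : (2 : ℝ) ≤ t := by exact_mod_cast ht2
    have hq2' : (2 : ℝ) ≤ q := by exact_mod_cast hq2
    rw [Nat.cast_sub (by omega)] at hcarry
    have h1 : (m (e i) : ℝ) * ((q - 1) * g i) < 1 := by
      have : ((q : ℝ) - 1) * g i < 1 / m (e i) := by push_cast at hcarry; linarith
      rwa [lt_div_iff₀ hmp, mul_comm] at this
    have h2 : (q : ℝ) * ((m (e i) : ℝ) * ((q - 1) * g i)) = (q - 1) * t := by rw [ht]; ring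
    have h3 : (q : ℝ) * ((m (e i) : ℝ) * ((q - 1) * g i)) < q * 1 :=
      mul_lt_mul_of_pos_left h1 hqp
    nlinarith
  interval_cases t
  · left
    have := ht.symm
    simpa [hmp.ne'] using this
  · right
    rw [eq_div_iff hmp.ne', mul_comm, ← ht]
    simp

end IsBalanced
end LatticePolytope

namespace LatticePolytope

variable {ι : Type*} [Fintype ι]

namespace IsBalanced

variable {s k v : ℕ} {n par : ℕ → ℕ} {e : ι → ℕ}

/-- The generator becomes the new node `s` of weight `q`. It is the parent of the roots of those
trees on which `q • g` is not integral, and the label of the coordinates outside all trees at which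
`g` is nonzero. The role of "no node" passes from `s` to `s + 1`. -/
theorem exists_extension (h : IsBalanced s n par e k) (hk : 1 ≤ k) {L : AddSubgroup (ι → ℝ)}
    (hL : HasBlockHeights L v k) (hle : forestLattice s n par e ≤ L) (hlt : placeValue n s < v) :
    ∃ (n' par' : ℕ → ℕ) (e' : ι → ℕ), IsBalanced (s + 1) n' par' e' k ∧
      forestLattice (s + 1) n' par' e' ≤ L := by
  classical
  obtain ⟨m, hm0, hm, hm1, hm2, hmx⟩ := h.forest.exists_degree
  obtain ⟨g, q, hg, hgs, hq2, ⟨x, hx0, hxd, hxi⟩, hgi⟩ :=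
    h.exists_generator hk hL hle hlt hm0 hm hm1 hmx
  have hq0 : (q : ℝ) ≠ 0 := by positivity
  have hmne : ∀ j ≤ s, (m j : ℝ) ≠ 0 := fun j hj => by have := hm1 j hj; positivity
  have hmhalf : ∀ j < s, (1 : ℝ) / m j ≤ 1 / 2 := fun j hj => by
    have : (2 : ℝ) ≤ m j := by exact_mod_cast hm2 j hj
    exact one_div_le_one_div_of_le (by norm_num) this
  have hmpos : ∀ j < s, (0 : ℝ) < 1 / m j := fun j hj => by
    have := hm2 j hj
    positivity
  -- Every node occurs as a label, so the alternative for `q * g i` can be recorded at nodes: `τ j =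
  -- 1` stands for `1 / m j` and `τ j = 0` for `0`.
  have hτ : ∀ j, ∃ τ : ℕ, (τ = 0 ∨ τ = 1) ∧ (j < s → (τ / m j : ℝ) - x j ∈ intSubring) := by
    intro j
    by_cases hj : j < s
    · obtain ⟨i, rfl⟩ := h.exists_label_eq hk hj
      have := hxi i
      rw [nsmul_pi_apply] at this
      rcases hgi i with h0 | h0
      · exact ⟨0, Or.inl rfl, fun _ => by simpa [h0] using this⟩
      · exact ⟨1, Or.inr rfl, fun _ => by simpa [h0] using this⟩
    · exact ⟨0, Or.inl rfl, fun h => absurd h hj⟩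
  choose τ hτ01 hτx using hτ
  have hτg : ∀ i, e i < s → q * g i = τ (e i) / m (e i) := by
    intro i hi
    have h1 := intSubring.sub_mem (hxi i) (hτx _ hi)
    rw [nsmul_pi_apply] at h1
    have h3 := hmhalf _ hi
    have h4 := hmpos _ hi
    have h2 := eq_zero_of_mem_intSubring (r := q * g i - τ (e i) / m (e i))
      (by convert h1 using 1; ring)
    rcases hgi i with h0 | h0 <;> rcases hτ01 (e i) with h5 | h5 <;>
      simp only [h0, h5, Nat.cast_zero, Nat.cast_one, zero_div] at h2 ⊢ <;>
      linarith [h2 (by linarith) (by linarith)]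
  -- The congruence at `j` makes `(τ j - τ (par j)) / m (par j)` an integer. As `m (par j) ≥ 2` it
  -- vanishes, so `τ` is constant on each tree.
  have hτpar : ∀ j < s, par j < s → τ j = τ (par j) := by
    intro j hj hpj
    have h1 := intSubring.sub_mem (intSubring.add_mem (hxd j hj) (intSubring.mul_mem
      (natCast_mem intSubring (n j)) (hτx j hj))) (hτx _ hpj)
    have h3 := hmhalf _ hpj
    have h4 := hmpos _ hpj
    have hn := h.forest.two_le j hj
    have hn0 : (n j : ℝ) ≠ 0 := by positivity
    have h5 := hmne _ hpj.le
    have h2 := eq_zero_of_mem_intSubring (r := (τ j - τ (par j)) * (1 / m (par j)))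
      (by
        convert h1 using 1
        rw [hm j hj, defect]
        push_cast
        field_simp
        ring)
    rcases hτ01 j with h6 | h6 <;> rcases hτ01 (par j) with h7 | h7 <;>
      simp only [h6, h7, Nat.cast_zero, Nat.cast_one] at h2 ⊢ <;>
      linarith [h2 (by linarith) (by linarith)]
  let n' := Function.update n s q
  let par' : ℕ → ℕ := fun j => if j = s then s + 1 else if par j = s ∧ τ j = 0 then s + 1 else par j
  let e' : ι → ℕ := fun i => if e i = s ∧ g i = 0 then s + 1 else e i
  -- The solution on the new forest that represents `g`: defect `0` at the old nodes and `1` at the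
  -- new node.
  let γ : ℕ → ℝ := fun j => if j < s then τ j / (q * m j) else if j = s then 1 / q else 0
  have hn'lt : ∀ j < s, n' j = n j := fun j hj => Function.update_of_ne hj.ne _ _
  have hn's : n' s = q := Function.update_self _ _ _
  have hpar's : par' s = s + 1 := if_pos rfl
  have hγs : γ s = 1 / q := by simp [γ]
  have hγs' : γ (s + 1) = 0 := by simp [γ]
  have hγe : ∀ i, g i = γ (e' i) := by
    intro i
    rcases (h.label_le i).lt_or_eq with hi | hi
    · have h1 : e' i = e i := if_neg fun h => hi.ne h.1
      have h2 : γ (e i) = τ (e i) / (q * m (e i)) := if_pos hi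
      have := hτg i hi
      rw [h1, h2, mul_comm (q : ℝ), ← div_div, ← this]
      field_simp
    · by_cases hgz : g i = 0
      · have h1 : e' i = s + 1 := if_pos ⟨hi, hgz⟩
        rw [h1, hγs', hgz]
      · have h1 : e' i = s := by
          have : e' i = e i := if_neg fun h => hgz h.2
          rw [this, hi]
        rw [h1, hγs]
        rcases hgi i with h0 | h0
        · exact absurd h0 (mul_ne_zero hq0 hgz)
        · rw [hi, hm0] at h0
          rw [eq_div_iff hq0, mul_comm, h0]
          simp
  have hpar' : ∀ j < s, ∀ z : ℕ → ℝ, z s = 0 → z (s + 1) = 0 → z (par' j) = z (par j) := by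
    intro j hj z hz hz'
    by_cases hc : par j = s ∧ τ j = 0
    · have h1 : par' j = s + 1 := by simp only [par', if_neg hj.ne, if_pos hc]
      rw [h1, hc.1, hz, hz']
    · have h1 : par' j = par j := by simp only [par', if_neg hj.ne, if_neg hc]
      rw [h1]
  have he' : ∀ i, ∀ z : ℕ → ℝ, z s = 0 → z (s + 1) = 0 → z (e' i) = z (e i) := by
    intro i z hz hz'
    by_cases hc : e i = s ∧ g i = 0
    · have h1 : e' i = s + 1 := if_pos hc
      rw [h1, hc.1, hz, hz']
    · have h1 : e' i = e i := if_neg hc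
      rw [h1]
  have hγd : ∀ j < s, defect n' par' γ j = 0 := by
    intro j hj
    have h1 : γ j = τ j / (q * m j) := if_pos hj
    have hn := h.forest.two_le j hj
    have hn0 : (n j : ℝ) ≠ 0 := by positivity
    rw [defect, hn'lt j hj, h1, hm j hj]
    rcases (h.forest.par_le j hj).lt_or_eq with hpj | hpj
    · have h2 : par' j = par j := by
        simp only [par', if_neg hj.ne]
        exact if_neg fun h => hpj.ne h.1
      have h3 : γ (par j) = τ (par j) / (q * m (par j)) := if_pos hpj
      have := hmne _ hpj.le
      rw [h2, h3, ← hτpar j hj hpj]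
      push_cast
      field_simp
      ring
    · rw [hpj, hm0]
      rcases hτ01 j with h6 | h6
      · have h2 : par' j = s + 1 := by
          simp only [par', if_neg hj.ne]
          exact if_pos ⟨hpj, h6⟩
        rw [h2, h6, hγs']
        simp
      · have h2 : par' j = s := by
          simp only [par', if_neg hj.ne]
          rw [if_neg (by simp [h6]), hpj]
        rw [h2, h6, hγs]
        push_cast
        field_simp
        ring
  -- A solution `z` on the new forest splits as a multiple of `γ`, with coefficient its defect `q *
  -- z s` at the new node, plus a remainder vanishing at `s`, which is a solution on the old forest.
  have hzs : ∀ z : ℕ → ℝ, (z - (q * z s) • γ) s = 0 := fun z => by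
    simp only [Pi.sub_apply, Pi.smul_apply, smul_eq_mul, hγs]
    field_simp
    ring
  have hzs' : ∀ z : ℕ → ℝ, z (s + 1) = 0 → (z - (q * z s) • γ) (s + 1) = 0 := fun z hz => by
    simp [hz, hγs']
  have hdefect : ∀ j < s, ∀ z : ℕ → ℝ, z (s + 1) = 0 →
      defect n par (z - (q * z s) • γ) j = defect n' par' z j := by
    intro j hj z hz
    have h1 : defect n' par' (z - (q * z s) • γ) j = defect n' par' z j := by
      rw [defect_sub, defect_smul, hγd j hj]
      ring
    rw [← h1, defect, defect, hn'lt j hj, hpar' j hj (z - (q * z s) • γ) (hzs z) (hzs' z hz)]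
  have hcoord : ∀ i, ∀ z : ℕ → ℝ, z (s + 1) = 0 →
      z (e' i) = (z - (q * z s) • γ) (e i) + q * z s * g i := by
    intro i z hz
    rw [← he' i (z - (q * z s) • γ) (hzs z) (hzs' z hz), hγe i]
    simp
  have hlast : ∀ z : ℕ → ℝ, z (s + 1) = 0 → defect n' par' z s = q * z s := by
    intro z hz
    rw [defect, hn's, hpar's, hz, sub_zero]
  refine ⟨n', par', e', ⟨⟨?_, ?_, ?_⟩, ?_, ?_⟩, ?_⟩
  · intro j hj
    rcases Nat.lt_succ_iff_lt_or_eq.1 hj with hj | rfl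
    · rw [hn'lt j hj]; exact h.forest.two_le j hj
    · rw [hn's]; exact hq2
  · intro j hj
    have := h.forest.lt_par j
    simp only [par']
    split_ifs <;> omega
  · intro j hj
    have := h.forest.par_le j
    simp only [par']
    split_ifs <;> omega
  · intro i
    have := h.label_le i
    simp only [e']
    split_ifs <;> omega
  · intro z hz
    rw [Finset.sum_congr rfl fun i _ => hcoord i z hz, Finset.sum_add_distrib, ← Finset.mul_sum, hgs,
      h.sum_eq _ (hzs z), Finset.sum_range_succ, hlast z hz, mul_add]
    have h1 : ∀ j ≤ s, placeValue n' j = placeValue n j := fun j hj =>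
      Finset.prod_congr rfl fun i hi => hn'lt i (by simp at hi; omega)
    rw [h1 s le_rfl]
    congr 1
    · congr 1
      refine Finset.sum_congr rfl fun j hj => ?_
      rw [Finset.mem_range] at hj
      rw [hdefect j hj z hz, h1 j hj.le]
    · ring
  · rintro a ⟨z, hz, hzd, hza⟩
    obtain ⟨t, ht⟩ := mem_intSubring.1 (hzd s (by omega))
    rw [hlast z hz] at ht
    have h1 : (fun i => (z - (q * z s) • γ) (e i)) ∈ L := hle
      ⟨z - (q * z s) • γ, hzs z, fun j hj => by
        rw [hdefect j hj z hz]; exact hzd j (by omega), fun i => by simp⟩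
    have h2 := hle (intSubring_mem_forestLattice (s := s) (n := n) (par := par) (e := e) hza)
    have h3 := L.add_mem h2 (L.add_mem h1 (L.zsmul_mem hg t))
    convert h3 using 1
    funext i
    have h4 : (t • g) i = t * g i := by simp
    simp only [Pi.add_apply, h4, ht]
    rw [← hcoord i z hz]
    ring

end IsBalanced

theorem two_pow_le_placeValue {s : ℕ} {n : ℕ → ℕ} (hn : ∀ j < s, 2 ≤ n j) :
    2 ^ s ≤ placeValue n s := by
  simpa [placeValue] using Finset.prod_le_prod' (f := fun _ => 2) (g := n) (s := Finset.range s)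
    fun i hi => hn i (by simpa using hi)

/-- A lattice whose unit box has the heights `0, k, …, (v - 1) k` is the lattice of a forest. -/
theorem HasBlockHeights.exists_isBalanced {L : AddSubgroup (ι → ℝ)} {v k : ℕ} (hk : 1 ≤ k)
    (hZ : ∀ a : ι → ℝ, (∀ i, a i ∈ intSubring) → a ∈ L) (hL : HasBlockHeights L v k) :
    ∃ (s : ℕ) (n par : ℕ → ℕ) (e : ι → ℕ), IsBalanced s n par e k ∧ placeValue n s = v ∧
      L = forestLattice s n par e := by
  have hk' : (k : ℝ) ≠ 0 := by positivity
  -- The top box element of the forest lattice, of height `k * (placeValue n s - 1)`, is also a box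
  -- element of `L`.
  have hbound : ∀ (s : ℕ) (n par : ℕ → ℕ) (e : ι → ℕ), IsBalanced s n par e k →
      forestLattice s n par e ≤ L → placeValue n s ≤ v := by
    intro s n par e h hle
    have hpos := h.forest.placeValue_pos le_rfl
    obtain ⟨a, ⟨ha, has⟩, -⟩ := (h.hasBlockHeights hk).1 (placeValue n s - 1) (by omega)
    obtain ⟨M, hM, hMs⟩ := hL.2 a ⟨hle ha.1, ha.2⟩
    rw [has] at hMs
    have : placeValue n s - 1 = M := by exact_mod_cast mul_left_cancel₀ hk' hMs
    omega
  have key : ∀ t, (∃ (s : ℕ) (n par : ℕ → ℕ) (e : ι → ℕ), IsBalanced s n par e k ∧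
      forestLattice s n par e ≤ L ∧ placeValue n s = v) ∨ ∃ (n par : ℕ → ℕ) (e : ι → ℕ),
      IsBalanced t n par e k ∧ forestLattice t n par e ≤ L := by
    intro t
    induction t with
    | zero =>
      -- The start is the empty forest, whose lattice is `ℤ^ι`; weights and parents are arbitrary as
      -- there are no nodes.
      refine Or.inr ⟨fun _ => 2, fun _ => 0, fun _ => 0, ⟨⟨by simp, by simp, by simp⟩, by simp,
        fun x hx => by simp [hx]⟩, ?_⟩
      rintro a ⟨x, hx, -, hxa⟩
      exact hZ a fun i => by simpa [hx] using hxa i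
    | succ t ih =>
      rcases ih with h | ⟨n, par, e, h, hle⟩
      · exact Or.inl h
      · rcases (hbound t n par e h hle).lt_or_eq with hlt | heq
        · exact Or.inr (h.exists_extension hk hL hle hlt)
        · exact Or.inl ⟨t, n, par, e, h, hle, heq⟩
  rcases key v with ⟨s, n, par, e, h, hle, hN⟩ | ⟨n, par, e, h, hle⟩
  · refine ⟨s, n, par, e, h, hN, le_antisymm (fun a ha => ?_) hle⟩
    -- Once the place value reaches `v`, every height of `L` is already attained in the forest
    -- lattice, so the boxes coincide.
    have hf := fract_mem_unitBox hZ ha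
    obtain ⟨M, hM, hMs⟩ := hL.2 _ hf
    obtain ⟨b, ⟨hb, hbs⟩, -⟩ := (h.hasBlockHeights hk).1 M (by omega)
    have h1 := (hL.1 M hM).unique ⟨hf, hMs⟩ ⟨⟨hle hb.1, hb.2⟩, hbs⟩
    have h2 := (forestLattice s n par e).add_mem hb.1
      (intSubring_mem_forestLattice fun i => sub_fract_mem_intSubring (a i))
    convert h2 using 1
    rw [← h1]
    funext i
    simp only [Pi.add_apply]
    ring
  · have h1 := hbound v n par e h hle
    -- Each node at least doubles the place value, so `v` nodes would give at least `2 ^ v > v`.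
    have h2 := two_pow_le_placeValue h.forest.two_le
    have h3 := v.lt_two_pow_self
    omega

end LatticePolytope

/-! ### Uniqueness of the forest and existence of balanced labellings. -/

namespace LatticePolytope

theorem sum_fract_eq {ι : Type*} [Fintype ι] {a b : ι → ℝ} (hb : ∀ i, 0 ≤ b i ∧ b i < 1)
    (hab : ∀ i, a i - b i ∈ intSubring) : ∑ i, Int.fract (a i) = ∑ i, b i :=
  Finset.sum_congr rfl fun i _ => by
    obtain ⟨z, hz⟩ := mem_intSubring.1 (hab i)
    exact Int.fract_eq_iff.2 ⟨(hb i).1, (hb i).2, z, hz.symm⟩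

theorem placeValue_congr {n n' : ℕ → ℕ} {j : ℕ} (h : ∀ i < j, n i = n' i) :
    placeValue n j = placeValue n' j :=
  Finset.prod_congr rfl fun i hi => h i (by simpa using hi)

theorem IsForest.placeValue_lt {s : ℕ} {n par : ℕ → ℕ} (h : IsForest s n par) {i : ℕ} (hi : i < s) :
    placeValue n i < placeValue n s := by
  have key : ∀ t, i + t + 1 ≤ s → placeValue n i < placeValue n (i + t + 1) := by
    intro t
    induction t with
    | zero =>
      intro ht
      have h1 := h.placeValue_pos hi.le
      have h2 := h.two_le i hi
      rw [placeValue_succ]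
      nlinarith
    | succ t ih =>
      intro ht
      have h1 := ih (by omega)
      have h2 := h.two_le (i + t + 1) (by omega)
      rw [← add_assoc, placeValue_succ _ (i + t + 1)]
      nlinarith
  have := key (s - i - 1) (by omega)
  rwa [show i + (s - i - 1) + 1 = s by omega] at this

namespace IsBalanced

variable {ι : Type*} [Fintype ι] {s k : ℕ} {n par : ℕ → ℕ} {e : ι → ℕ}

/-- The number `placeValue n j` has a single nonzero digit, a `1` in position `j`. -/
theorem eq_of_sum_eq_placeValue (h : IsBalanced s n par e k) (hk : 1 ≤ k) {w : ι → ℝ}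
    (hw : w ∈ unitBox (forestLattice s n par e)) {j : ℕ} (hj : j < s)
    (hs : ∑ i, w i = k * placeValue n j) :
    ∃ x : ℕ → ℝ, x s = 0 ∧ (∀ c < s, defect n par x c = if c = j then 1 else 0) ∧
      w = fun i => x (e i) := by
  obtain ⟨x, h0, hx⟩ := h.forest.exists_defect_eq fun c => if c = j then 1 else 0
  have h1 := h.mem_unitBox_of_digits (y := fun c => if c = j then 1 else 0) h0 fun c hc =>
    ⟨by have := h.forest.two_le c hc; split_ifs <;> omega, by rw [hx c hc]; push_cast; rfl⟩
  refine ⟨x, h0, hx, ((h.hasBlockHeights hk).1 _ (h.forest.placeValue_lt hj)).unique ⟨hw, hs⟩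
    ⟨h1.1, ?_⟩⟩
  rw [h1.2]
  simp [hj]

theorem sum_fract_nsmul_of_lt (h : IsBalanced s n par e k) (hk : 1 ≤ k) {w : ι → ℝ}
    (hw : w ∈ unitBox (forestLattice s n par e)) {j : ℕ} (hj : j < s)
    (hs : ∑ i, w i = k * placeValue n j) {q : ℕ} (hq : q < n j) :
    ∑ i, Int.fract (q * w i) = k * (placeValue n j * q : ℕ) := by
  obtain ⟨x, h0, hx, rfl⟩ := h.eq_of_sum_eq_placeValue hk hw hj hs
  have h1 := h.mem_unitBox_of_digits (x := (q : ℝ) • x) (y := fun c => if c = j then q else 0)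
    (by simp [h0]) fun c hc => by
      constructor
      · have := h.forest.two_le c hc
        split_ifs with hcj
        · rwa [hcj]
        · omega
      · rw [defect_smul, hx c hc]
        split_ifs <;> simp
  rw [sum_fract_eq h1.1.2 (fun i => by simp), h1.2]
  simp [hj]

/-- The vector `n j • x` has defect `n j` at `j` only. Subtracting the indicator of `j` removes this
and creates defect `1` at each child of `j`, so modulo integers one gets the box element whose
digits mark the children. -/
theorem sum_fract_nsmul_self (h : IsBalanced s n par e k) (hk : 1 ≤ k) {w : ι → ℝ}
    (hw : w ∈ unitBox (forestLattice s n par e)) {j : ℕ} (hj : j < s)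
    (hs : ∑ i, w i = k * placeValue n j) :
    ∑ i, Int.fract (n j * w i) =
      k * (∑ c ∈ Finset.range s, placeValue n c * if par c = j then 1 else 0 : ℕ) := by
  obtain ⟨x, h0, hx, rfl⟩ := h.eq_of_sum_eq_placeValue hk hw hj hs
  obtain ⟨z, hz0, hz⟩ := h.forest.exists_defect_eq fun c => if par c = j then 1 else 0
  have h1 := h.mem_unitBox_of_digits (y := fun c => if par c = j then 1 else 0) hz0 fun c hc =>
    ⟨by have := h.forest.two_le c hc; split_ifs <;> omega, by rw [hz c hc]; push_cast; rfl⟩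
  have h2 : ∀ c ≤ s, ((n j : ℝ) • x - z) c = (Pi.single j 1 : ℕ → ℝ) c :=
    h.forest.eq_of_defect_eq (by simp [h0, hz0, hj.ne']) fun c hc => by
      rw [defect_sub, defect_smul, hx c hc, hz c hc, defect]
      by_cases hcj : c = j
      · subst hcj; simp [Pi.single_apply]
      · simp [Pi.single_apply, hcj]
  rw [sum_fract_eq h1.1.2 (fun i => ?_), h1.2]
  have h3 := h2 _ (h.label_le i)
  simp only [Pi.sub_apply, Pi.smul_apply, smul_eq_mul, Pi.single_apply] at h3
  rw [h3]
  split_ifs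
  · exact intSubring.one_mem
  · exact intSubring.zero_mem

variable {s' : ℕ} {n' par' : ℕ → ℕ} {e' : ι → ℕ}

/-- If `n j < n' j`, then `n j * w` has height `k * placeValue n j * n j` by the second forest,
whereas by the first it is a sum over children, below `k * placeValue n j`. -/
theorem weight_le (h : IsBalanced s n par e k) (h' : IsBalanced s' n' par' e' k) (hk : 1 ≤ k)
    (hL : forestLattice s n par e = forestLattice s' n' par' e') {j : ℕ} (hj : j < s)
    (hj' : j < s') (heq : ∀ i < j, n i = n' i) : n' j ≤ n j := by
  by_contra! hlt
  have hN := placeValue_congr heq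
  obtain ⟨w, ⟨hw, hws⟩, -⟩ := (h.hasBlockHeights hk).1 _ (h.forest.placeValue_lt hj)
  have h1 := h.sum_fract_nsmul_self hk hw hj hws
  have h2 := h'.sum_fract_nsmul_of_lt hk (hL ▸ hw) hj' (hN ▸ hws) hlt
  rw [h1, ← hN] at h2
  have hk' : (k : ℝ) ≠ 0 := by positivity
  have h3 : (∑ c ∈ Finset.range s, placeValue n c * if par c = j then 1 else 0) =
      placeValue n j * n j := by exact_mod_cast mul_left_cancel₀ hk' h2
  have h4 := sum_children_lt h.forest hj
  simp only [mul_ite, mul_one, mul_zero, ← Finset.sum_filter] at h3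
  have := h.forest.two_le j hj
  nlinarith

/-- Both forests express one height by digits in `{0, 1}` that mark the children of `par c`;
uniqueness of digits identifies the children. -/
theorem par_eq_of_lt (h : IsBalanced s n par e k) (h' : IsBalanced s n' par' e' k) (hk : 1 ≤ k)
    (hL : forestLattice s n par e = forestLattice s n' par' e') (hn : ∀ j < s, n j = n' j)
    {c : ℕ} (hc : c < s) (hpc : par c < s) : par' c = par c := by
  have hN : ∀ j ≤ s, placeValue n j = placeValue n' j := fun j hj =>
    placeValue_congr fun i hi => hn i (by omega)
  obtain ⟨w, ⟨hw, hws⟩, -⟩ := (h.hasBlockHeights hk).1 _ (h.forest.placeValue_lt hpc)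
  have h1 := h.sum_fract_nsmul_self hk hw hpc hws
  have h2 := h'.sum_fract_nsmul_self hk (hL ▸ hw) hpc (hN _ hpc.le ▸ hws)
  rw [← hn _ hpc, h1] at h2
  have hk' : (k : ℝ) ≠ 0 := by positivity
  have h3 : (∑ i ∈ Finset.range s, placeValue n i * if par i = par c then 1 else 0) =
      ∑ i ∈ Finset.range s, placeValue n' i * if par' i = par c then 1 else 0 := by
    exact_mod_cast mul_left_cancel₀ hk' h2
  have h4 : (∑ i ∈ Finset.range s, placeValue n' i * if par' i = par c then 1 else 0) =
      ∑ i ∈ Finset.range s, placeValue n i * if par' i = par c then 1 else 0 :=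
    Finset.sum_congr rfl fun i hi => by rw [hN i (Finset.mem_range.1 hi).le]
  rw [h4] at h3
  have h5 : ∀ p : ℕ → ℕ, ∀ i < s, (if p i = par c then 1 else 0) < n i := fun p i hi => by
    have := h.forest.two_le i hi
    split_ifs <;> omega
  have h6 := digits_unique n s _ _ (h5 par) (h5 par') h3 c hc
  by_contra hne
  simp [hne] at h6

/-- The weighted forest is determined by its lattice. -/
theorem unique (h : IsBalanced s n par e k) (h' : IsBalanced s' n' par' e' k) (hk : 1 ≤ k)
    (hv : placeValue n s = placeValue n' s')
    (hL : forestLattice s n par e = forestLattice s' n' par' e') :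
    s = s' ∧ ∀ j < s, n j = n' j ∧ par j = par' j := by
  have key : ∀ j, j ≤ s → j ≤ s' → ∀ i < j, n i = n' i := by
    intro j
    induction j with
    | zero => simp
    | succ j ih =>
      intro hj hj' i hi
      have heq := ih (by omega) (by omega)
      rcases Nat.lt_succ_iff_lt_or_eq.1 hi with hi | rfl
      · exact heq i hi
      · exact le_antisymm
          (h'.weight_le h hk hL.symm (by omega) (by omega) fun i hi => (heq i hi).symm)
          (h.weight_le h' hk hL (by omega) (by omega) heq)
  obtain rfl : s = s' := by
    rcases lt_trichotomy s s' with hlt | heq | hlt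
    · have h1 := h'.forest.placeValue_lt hlt
      rw [← placeValue_congr (key s le_rfl hlt.le)] at h1
      omega
    · exact heq
    · have h1 := h.forest.placeValue_lt hlt
      rw [placeValue_congr (key s' hlt.le le_rfl)] at h1
      omega
  have hn := key s le_rfl le_rfl
  refine ⟨rfl, fun j hj => ⟨hn j hj, ?_⟩⟩
  rcases (h.forest.par_le j hj).lt_or_eq with h1 | h1
  · exact (h.par_eq_of_lt h' hk hL hn hj h1).symm
  · rcases (h'.forest.par_le j hj).lt_or_eq with h2 | h2
    · exact h'.par_eq_of_lt h hk hL.symm (fun j hj => (hn j hj).symm) hj h2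
    · rw [h1, h2]

end IsBalanced

/-- Every weighted forest has a balanced labelling. -/
theorem IsForest.exists_isBalanced {s : ℕ} {n par : ℕ → ℕ} (h : IsForest s n par) (hs : 1 ≤ s)
    {k : ℕ} (hk : 1 ≤ k) :
    ∃ (d : ℕ) (e : Fin (d + 1) → ℕ), IsBalanced s n par e k ∧ ∀ i, e i < s := by
  classical
  -- These multiplicities are the ones dictated by `IsBalanced.card_label`; their sum is `d + 1`.
  let c : ℕ → ℕ := fun j => k * placeValue n (j + 1) -
    k * ∑ i ∈ Finset.range s with par i = j, placeValue n i
  have hc : ∀ j < s, c j + k * ∑ i ∈ Finset.range s with par i = j, placeValue n i =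
      k * placeValue n (j + 1) ∧ 0 < c j := by
    intro j hj
    have h1 := IsBalanced.sum_children_lt h hj
    have h2 := h.two_le j hj
    have h3 : ∑ i ∈ Finset.range s with par i = j, placeValue n i < placeValue n (j + 1) := by
      rw [placeValue_succ]; nlinarith
    have h4 := Nat.mul_lt_mul_of_pos_left h3 hk
    simp only [c]
    omega
  have hcard : Fintype.card (Σ j : Fin s, Fin (c j)) = ∑ j : Fin s, c j := by simp
  have hpos : 0 < ∑ j : Fin s, c j :=
    (hc 0 hs).2.trans_le (Finset.single_le_sum (f := fun j : Fin s => c j)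
      (fun _ _ => Nat.zero_le _) (Finset.mem_univ ⟨0, hs⟩))
  obtain ⟨d, hd⟩ := Nat.exists_eq_succ_of_ne_zero hpos.ne'
  let E : Fin (d + 1) ≃ Σ j : Fin s, Fin (c j) :=
    (Fintype.equivFinOfCardEq (hcard.trans hd)).symm
  refine ⟨d, fun i => (E i).1, ⟨h, fun i => (E i).1.2.le, fun x hx => ?_⟩, fun i => (E i).1.2⟩
  have h1 : ∑ i, x (E i).1 = ∑ j ∈ Finset.range s, (c j : ℝ) * x j := by
    rw [E.sum_comp fun p => x p.1, Fintype.sum_sigma, Finset.sum_range]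
    simp
  -- The sum is grouped by parents; the roots contribute nothing because `x s = 0`.
  have h2 : ∑ i ∈ Finset.range s, (placeValue n i : ℝ) * x (par i) =
      ∑ j ∈ Finset.range s, (∑ i ∈ Finset.range s with par i = j, (placeValue n i : ℝ)) * x j := by
    have h3 : ∑ j ∈ Finset.range (s + 1), (∑ i ∈ Finset.range s with par i = j,
        (placeValue n i : ℝ) * x (par i)) = ∑ i ∈ Finset.range s, (placeValue n i : ℝ) * x (par i) :=
      Finset.sum_fiberwise_of_maps_to (fun i hi => by
        have := h.par_le i (Finset.mem_range.1 hi)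
        simp only [Finset.mem_range]; omega) _
    rw [← h3, Finset.sum_range_succ]
    have h4 : ∀ j, ∑ i ∈ Finset.range s with par i = j, (placeValue n i : ℝ) * x (par i) =
        (∑ i ∈ Finset.range s with par i = j, (placeValue n i : ℝ)) * x j := fun j => by
      rw [Finset.sum_mul]
      exact Finset.sum_congr rfl fun i hi => by rw [(Finset.mem_filter.1 hi).2]
    simp only [h4, hx, mul_zero, add_zero]
  simp only [defect, mul_sub, Finset.sum_sub_distrib]
  rw [h1, h2, Finset.mul_sum, Finset.mul_sum, ← Finset.sum_sub_distrib]
  refine Finset.sum_congr rfl fun j hj => ?_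
  have h5 := (hc j (Finset.mem_range.1 hj)).1
  rw [placeValue_succ] at h5
  have h6 : (c j : ℝ) + k * ∑ i ∈ Finset.range s with par i = j, (placeValue n i : ℝ) =
      k * (placeValue n j * n j) := by exact_mod_cast h5
  have h7 : (c j : ℝ) = k * (placeValue n j * n j) -
      k * ∑ i ∈ Finset.range s with par i = j, (placeValue n i : ℝ) := by linarith
  rw [h7]
  ring

/-- Balanced labellings of the same weighted forest agree up to a permutation. -/
theorem IsBalanced.exists_perm {s k d d' : ℕ} {n par n' par' : ℕ → ℕ} {e : Fin (d + 1) → ℕ}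
    {e' : Fin (d' + 1) → ℕ} (h : IsBalanced s n par e k) (h' : IsBalanced s n' par' e' k)
    (hn : ∀ j < s, n j = n' j ∧ par j = par' j) (he : ∀ i, e i < s) (he' : ∀ i, e' i < s) :
    ∃ E : Fin (d + 1) ≃ Fin (d' + 1), ∀ i, e' (E i) = e i := by
  -- Multiplicities depend on the forest and `k` alone, by `card_label`.
  have hcard : ∀ j, Fintype.card {i // e i = j} = Fintype.card {i // e' i = j} := by
    intro j
    rw [Fintype.card_subtype, Fintype.card_subtype]
    by_cases hj : j < s
    · have h1 := h.card_label hj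
      have h2 := h'.card_label hj
      rw [← placeValue_congr (j := j + 1) fun i hi => (hn i (by omega)).1] at h2
      have h3 : ∑ c ∈ Finset.range s with par' c = j, placeValue n' c =
          ∑ c ∈ Finset.range s with par c = j, placeValue n c := by
        rw [Finset.sum_filter, Finset.sum_filter]
        refine Finset.sum_congr rfl fun c hc => ?_
        rw [Finset.mem_range] at hc
        rw [(hn c hc).2, placeValue_congr (j := c) fun i hi => (hn i (by omega)).1]
      rw [h3] at h2
      omega
    · have h1 : (Finset.univ.filter fun i => e i = j) = ∅ :=
        Finset.filter_eq_empty_iff.2 fun i _ hi => hj (by rw [← hi]; exact he i)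
      have h2 : (Finset.univ.filter fun i => e' i = j) = ∅ :=
        Finset.filter_eq_empty_iff.2 fun i _ hi => hj (by rw [← hi]; exact he' i)
      rw [h1, h2]
      rfl
  have hE : ∀ j, Nonempty ({i // e i = j} ≃ {i // e' i = j}) := fun j =>
    ⟨Fintype.equivOfCardEq (hcard j)⟩
  exact ⟨(Equiv.sigmaFiberEquiv e).symm.trans ((Equiv.sigmaCongrRight fun j => (hE j).some).trans
    (Equiv.sigmaFiberEquiv e')), fun i => ((hE (e i)).some ⟨i, rfl⟩).2⟩

/-- In the box element with the single digit `1` at node `e i`, an integral coordinate would be `0`,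
leaving the defect `-x (par (e i)) ≤ 0` instead of `1`. -/
theorem IsBalanced.exists_not_mem_intSubring {ι : Type*} [Fintype ι] {s k : ℕ} {n par : ℕ → ℕ}
    {e : ι → ℕ} (h : IsBalanced s n par e k) {i : ι} (hi : e i < s) :
    ∃ a ∈ forestLattice s n par e, a i ∉ intSubring := by
  obtain ⟨x, h0, hx⟩ := h.forest.exists_defect_eq fun c => if c = e i then 1 else 0
  obtain ⟨⟨hmem, hb⟩, -⟩ := h.mem_unitBox_of_digits (y := fun c => if c = e i then 1 else 0) h0
    fun c hc => ⟨by have := h.forest.two_le c hc; split_ifs <;> omega, by rw [hx c hc]; push_cast; rfl⟩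
  refine ⟨_, hmem, fun hint => ?_⟩
  have h1 := eq_zero_of_mem_intSubring hint (by linarith [(hb i).1]) (hb i).2
  have h2 := hx _ hi
  rw [defect, if_pos rfl, h1] at h2
  have h3 := (h.forest.mem_Ico_of_digit (y := fun c => if c = e i then 1 else 0) h0
    (fun c hc => ⟨by have := h.forest.two_le c hc; split_ifs <;> omega,
      by rw [hx c hc]; push_cast; rfl⟩) _ (h.forest.par_le _ hi)).1
  linarith

theorem IsBalanced.label_lt {ι : Type*} [Fintype ι] {s k : ℕ} {n par : ℕ → ℕ}
    {e : ι → ℕ} (h : IsBalanced s n par e k) {i : ι}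
    (hi : ∃ a ∈ forestLattice s n par e, a i ∉ intSubring) : e i < s := by
  refine lt_of_le_of_ne (h.label_le i) fun heq => ?_
  obtain ⟨a, ⟨x, h0, -, hx⟩, hai⟩ := hi
  have := hx i
  rw [heq, h0, sub_zero] at this
  exact hai this

theorem forestLattice_congr {ι : Type*} {s : ℕ} {n par n' par' : ℕ → ℕ} (e : ι → ℕ)
    (hn : ∀ j < s, n j = n' j ∧ par j = par' j) :
    forestLattice s n par e = forestLattice s n' par' e := by
  ext a
  simp only [mem_forestLattice]
  refine exists_congr fun x => and_congr_right fun _ => and_congr_left fun _ =>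
    forall₂_congr fun j hj => ?_
  rw [defect, defect, (hn j hj).1, (hn j hj).2]

end LatticePolytope

/-! ### Barycentric lattices and unimodular equivalence. -/

namespace LatticePolytope

variable {d : ℕ}

/-- The linear map sending barycentric weights `a` to `(∑ a i v i, ∑ a i)`. -/
noncomputable def baryMap (v : Fin (d + 1) → Fin d → ℝ) :
    (Fin (d + 1) → ℝ) →ₗ[ℝ] (Fin d → ℝ) × ℝ where
  toFun a := (∑ i, a i • v i, ∑ i, a i)
  map_add' a b := by simp [add_smul, Finset.sum_add_distrib]
  map_smul' c a := by simp [mul_smul, Finset.smul_sum, Finset.mul_sum]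

theorem baryMap_apply (v : Fin (d + 1) → Fin d → ℝ) (a : Fin (d + 1) → ℝ) :
    baryMap v a = (∑ i, a i • v i, ∑ i, a i) := rfl

theorem baryMap_injective {v : Fin (d + 1) → Fin d → ℝ} (hv : AffineIndependent ℝ v) :
    Function.Injective (baryMap v) := by
  rw [← LinearMap.ker_eq_bot, LinearMap.ker_eq_bot']
  intro a ha
  rw [baryMap_apply, Prod.mk_eq_zero] at ha
  funext i
  exact affineIndependent_iff.1 hv Finset.univ a ha.2 ha.1 i (Finset.mem_univ i)

theorem affineIndependent_of_baryMap_injective {v : Fin (d + 1) → Fin d → ℝ}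
    (hv : Function.Injective (baryMap v)) : AffineIndependent ℝ v := by
  rw [affineIndependent_iff_of_fintype]
  intro w hw0 hw i
  rw [Finset.univ.weightedVSub_eq_linear_combination hw0] at hw
  have : baryMap v w = baryMap v 0 := by
    rw [map_zero, baryMap_apply, hw, hw0]; rfl
  exact congrFun (hv this) i

/-- Homogeneous barycentric coordinates with respect to an affinely independent family. -/
noncomputable def baryEquiv {v : Fin (d + 1) → Fin d → ℝ} (hv : AffineIndependent ℝ v) :
    (Fin (d + 1) → ℝ) ≃ₗ[ℝ] (Fin d → ℝ) × ℝ :=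
  LinearEquiv.ofInjectiveOfFinrankEq (baryMap v) (baryMap_injective hv) (by simp)

theorem baryEquiv_apply {v : Fin (d + 1) → Fin d → ℝ} (hv : AffineIndependent ℝ v)
    (a : Fin (d + 1) → ℝ) : baryEquiv hv a = (∑ i, a i • v i, ∑ i, a i) := rfl

theorem mem_convexHull_range_iff {ι E : Type*} [Fintype ι] [AddCommGroup E] [Module ℝ E]
    (v : ι → E) (x : E) : x ∈ convexHull ℝ (Set.range v) ↔
      ∃ a : ι → ℝ, (∀ i, 0 ≤ a i) ∧ ∑ i, a i = 1 ∧ ∑ i, a i • v i = x := by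
  classical
  constructor
  · intro hx
    have hc : Convex ℝ {x | ∃ a : ι → ℝ, (∀ i, 0 ≤ a i) ∧ ∑ i, a i = 1 ∧ ∑ i, a i • v i = x} := by
      rintro _ ⟨a, ha0, ha1, rfl⟩ _ ⟨b, hb0, hb1, rfl⟩ s t hs ht hst
      refine ⟨fun i => s * a i + t * b i, fun i => ?_, ?_, ?_⟩
      · have := ha0 i; have := hb0 i; positivity
      · rw [Finset.sum_add_distrib, ← Finset.mul_sum, ← Finset.mul_sum, ha1, hb1]; linarith
      · simp [add_smul, Finset.sum_add_distrib, mul_smul, Finset.smul_sum]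
    refine convexHull_min ?_ hc hx
    rintro _ ⟨i, rfl⟩
    refine ⟨Pi.single i 1, fun j => ?_, by simp, by simp [Pi.single_apply]⟩
    rw [Pi.single_apply]; split_ifs <;> norm_num
  · rintro ⟨a, ha0, ha1, rfl⟩
    exact (convex_convexHull ℝ _).sum_mem (fun i _ => ha0 i) ha1
      fun i _ => subset_convexHull ℝ _ ⟨i, rfl⟩

/-- The weights `a` for which both `∑ a i` and `∑ a i v i` are integral. -/
def baryLattice (v : Fin (d + 1) → Fin d → ℝ) : AddSubgroup (Fin (d + 1) → ℝ) where
  carrier := {a | ∑ i, a i ∈ intSubring ∧ ∀ c, (∑ i, a i • v i) c ∈ intSubring}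
  zero_mem' := by simp
  add_mem' := by
    rintro a b ⟨h1, h2⟩ ⟨h3, h4⟩
    refine ⟨?_, fun c => ?_⟩
    · simpa [Finset.sum_add_distrib] using intSubring.add_mem h1 h3
    · simpa [Finset.sum_add_distrib, add_smul] using intSubring.add_mem (h2 c) (h4 c)
  neg_mem' := by
    rintro a ⟨h1, h2⟩
    refine ⟨?_, fun c => ?_⟩
    · simpa using intSubring.neg_mem h1
    · simpa using intSubring.neg_mem (h2 c)

theorem mem_baryLattice {v : Fin (d + 1) → Fin d → ℝ} {a : Fin (d + 1) → ℝ} :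
    a ∈ baryLattice v ↔ ∑ i, a i ∈ intSubring ∧ ∀ c, (∑ i, a i • v i) c ∈ intSubring := Iff.rfl

theorem mem_integerPoints {x : Fin d → ℝ} : x ∈ integerPoints d ↔ ∀ c, x c ∈ intSubring := by
  constructor
  · rintro ⟨z, rfl⟩ c
    exact intCast_mem _ _
  · intro h
    choose z hz using fun c => mem_intSubring.1 (h c)
    exact ⟨z, funext hz⟩

theorem intSubring_mem_baryLattice {v : Fin (d + 1) → Fin d → ℝ} (hv : ∀ j, v j ∈ integerPoints d)
    {a : Fin (d + 1) → ℝ} (ha : ∀ i, a i ∈ intSubring) : a ∈ baryLattice v := by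
  refine ⟨intSubring.sum_mem fun i _ => ha i, fun c => ?_⟩
  rw [Finset.sum_apply]
  exact intSubring.sum_mem fun i _ => intSubring.mul_mem (ha i) (mem_integerPoints.1 (hv i) c)

theorem exists_matrix_of_maps_integerPoints (T : (Fin d → ℝ) →ₗ[ℝ] (Fin d → ℝ))
    (hT : ∀ x ∈ integerPoints d, T x ∈ integerPoints d) :
    ∃ U : Matrix (Fin d) (Fin d) ℤ, ∀ x, Matrix.vecMul x (U.map (Int.cast : ℤ → ℝ)) = T x := by
  have h : ∀ i : Fin d, ∃ z : Fin d → ℤ, (fun c => (z c : ℝ)) = T (Pi.single i 1) := fun i =>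
    hT _ ⟨Pi.single i 1, by funext c; simp [Pi.single_apply]⟩
  choose z hz using h
  refine ⟨Matrix.of z, fun x => ?_⟩
  conv_rhs => rw [← Finset.univ_sum_single x]
  funext c
  simp only [Matrix.vecMul, dotProduct, Matrix.map_apply, Matrix.of_apply, map_sum, Finset.sum_apply]
  refine Finset.sum_congr rfl fun i _ => ?_
  have h1 : (Pi.single i (x i) : Fin d → ℝ) = x i • Pi.single i 1 := by
    funext c; simp [Pi.single_apply]
  rw [h1, map_smul, ← hz i]
  rfl

/-- Simplices with the same lattice of barycentric coordinates are unimodularly equivalent. -/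
theorem unimodularlyEquivalent_of_baryLattice_eq {v v' : Fin (d + 1) → Fin d → ℝ}
    (hv : AffineIndependent ℝ v) (hv' : AffineIndependent ℝ v')
    (h : baryLattice v = baryLattice v') :
    UnimodularlyEquivalent (convexHull ℝ (Set.range v)) (convexHull ℝ (Set.range v')) := by
  -- The map `baryMap v' ∘ (baryEquiv hv).symm` preserves `ℤ^d × ℤ` and the last coordinate. On
  -- height `0` it is the matrix `U`, and the image of `(0, 1)` is the translation `w`.
  have key : ∀ {v v' : Fin (d + 1) → Fin d → ℝ} (hv : AffineIndependent ℝ v)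
      (_ : baryLattice v = baryLattice v') (x : Fin d → ℝ) (t : ℤ), x ∈ integerPoints d →
      (baryMap v' ((baryEquiv hv).symm (x, t))).1 ∈ integerPoints d := by
    intro v v' hv h x t hx
    have h1 := (baryEquiv hv).apply_symm_apply (x, (t : ℝ))
    rw [baryEquiv_apply, Prod.mk.injEq] at h1
    have h2 : (baryEquiv hv).symm (x, (t : ℝ)) ∈ baryLattice v :=
      ⟨by rw [h1.2]; exact intCast_mem _ _, fun c => by rw [h1.1]; exact mem_integerPoints.1 hx c⟩
    rw [h] at h2
    exact mem_integerPoints.2 h2.2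
  have hsum : ∀ {v v' : Fin (d + 1) → Fin d → ℝ} (hv : AffineIndependent ℝ v) (y),
      (baryMap v' ((baryEquiv hv).symm y)).2 = y.2 := by
    intro v v' hv y
    have h1 := (baryEquiv hv).apply_symm_apply y
    rw [baryEquiv_apply, Prod.ext_iff] at h1
    exact h1.2
  let T : ∀ {v : Fin (d + 1) → Fin d → ℝ} (_ : AffineIndependent ℝ v)
    (_ : Fin (d + 1) → Fin d → ℝ), (Fin d → ℝ) →ₗ[ℝ] (Fin d → ℝ) := fun hv v' =>
    LinearMap.fst ℝ _ _ ∘ₗ baryMap v' ∘ₗ (baryEquiv hv).symm.toLinearMap ∘ₗ LinearMap.inl ℝ _ _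
  have hT : ∀ {v v' : Fin (d + 1) → Fin d → ℝ} (hv : AffineIndependent ℝ v) (x),
      T hv v' x = (baryMap v' ((baryEquiv hv).symm (x, 0))).1 := fun hv x => rfl
  obtain ⟨U, hU⟩ := exists_matrix_of_maps_integerPoints (T hv v') fun x hx => by
    simpa [hT] using key hv h x 0 hx
  obtain ⟨U', hU'⟩ := exists_matrix_of_maps_integerPoints (T hv' v) fun x hx => by
    simpa [hT] using key hv' h.symm x 0 hx
  obtain ⟨w, hw⟩ := key hv h 0 1 ⟨0, by funext; simp⟩
  have hTT : ∀ x, T hv' v (T hv v' x) = x := by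
    intro x
    rw [hT, hT]
    have h1 : ((baryMap v' ((baryEquiv hv).symm (x, 0))).1, (0 : ℝ)) =
        baryEquiv hv' ((baryEquiv hv).symm (x, 0)) := Prod.ext rfl (hsum hv (x, 0)).symm
    rw [h1, LinearEquiv.symm_apply_apply]
    exact congrArg Prod.fst ((baryEquiv hv).apply_symm_apply (x, 0))
  have hUU : U * U' = 1 := by
    have hm : (U * U').map (Int.cast : ℤ → ℝ) = U.map Int.cast * U'.map Int.cast :=
      Matrix.map_mul (f := Int.castRingHom ℝ)
    have h1 : (U * U').map (Int.cast : ℤ → ℝ) = (1 : Matrix (Fin d) (Fin d) ℤ).map Int.cast := by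
      rw [hm]
      ext i j
      have h2 : Matrix.vecMul (Pi.single i 1) (U.map (Int.cast : ℤ → ℝ) * U'.map Int.cast) =
          Pi.single i 1 := by
        rw [← Matrix.vecMul_vecMul, hU, hU', hTT]
      have h3 := congrFun h2 j
      rw [Matrix.single_one_vecMul] at h3
      simp only [Matrix.row_apply] at h3
      rw [h3]
      simp [Matrix.one_apply, Pi.single_apply, eq_comm]
    exact Matrix.map_injective Int.cast_injective h1
  have hf : ∀ x, integerAffineMap U w x = (baryMap v' ((baryEquiv hv).symm (x, 1))).1 := by
    intro x
    have h1 : ((x, 1) : (Fin d → ℝ) × ℝ) = (x, 0) + (0, 1) := by simp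
    rw [integerAffineMap, hU, hT, h1, map_add, map_add, Prod.fst_add]
    simp only [Int.cast_one] at hw
    rw [← hw]
  refine ⟨U, w, IsUnit.of_mul_eq_one U'.det (by rw [← Matrix.det_mul, hUU, Matrix.det_one]), ?_⟩
  ext y
  simp only [Set.mem_image, mem_convexHull_range_iff]
  have h2 : ∀ a : Fin (d + 1) → ℝ, ∑ i, a i = 1 →
      (baryEquiv hv).symm (∑ i, a i • v i, 1) = a := by
    intro a ha
    rw [LinearEquiv.symm_apply_eq, baryEquiv_apply, ha]
  constructor
  · rintro ⟨a, ha0, ha1, rfl⟩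
    exact ⟨_, ⟨a, ha0, ha1, rfl⟩, by rw [hf, h2 a ha1, baryMap_apply]⟩
  · rintro ⟨x, ⟨a, ha0, ha1, rfl⟩, rfl⟩
    exact ⟨a, ha0, ha1, by rw [hf, h2 a ha1, baryMap_apply]⟩

theorem integerAffineMap_sum {ι : Type*} [Fintype ι] (U : Matrix (Fin d) (Fin d) ℤ) (w : Fin d → ℤ)
    (v : ι → Fin d → ℝ) (a : ι → ℝ) :
    ∑ i, a i • integerAffineMap U w (v i) =
      Matrix.vecMul (∑ i, a i • v i) (U.map (Int.cast : ℤ → ℝ)) + (∑ i, a i) • fun c => (w c : ℝ) := by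
  simp only [integerAffineMap, smul_add, Finset.sum_add_distrib, Matrix.sum_vecMul,
    Matrix.smul_vecMul, Finset.sum_smul]

theorem baryLattice_le_comp (U : Matrix (Fin d) (Fin d) ℤ) (w : Fin d → ℤ)
    (v : Fin (d + 1) → Fin d → ℝ) :
    baryLattice v ≤ baryLattice fun i => integerAffineMap U w (v i) := by
  rintro a ⟨h1, h2⟩
  refine ⟨h1, fun c => ?_⟩
  rw [integerAffineMap_sum]
  refine intSubring.add_mem ?_ (intSubring.mul_mem h1 (intCast_mem _ _))
  simp only [Matrix.vecMul, dotProduct, Matrix.map_apply]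
  exact intSubring.sum_mem fun i _ => intSubring.mul_mem (h2 i) (intCast_mem _ _)

theorem exists_inverse_integerAffineMap {U : Matrix (Fin d) (Fin d) ℤ} (w : Fin d → ℤ)
    (hU : IsUnit U.det) : ∃ (U' : Matrix (Fin d) (Fin d) ℤ) (w' : Fin d → ℤ), IsUnit U'.det ∧
      ∀ x, integerAffineMap U' w' (integerAffineMap U w x) = x := by
  refine ⟨U⁻¹, -Matrix.vecMul w U⁻¹, (Matrix.isUnit_nonsing_inv_det_iff).2 hU, fun x => ?_⟩
  have hm : U.map (Int.cast : ℤ → ℝ) * U⁻¹.map Int.cast = 1 := by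
    have h1 : (U * U⁻¹).map (Int.castRingHom ℝ) =
        U.map (Int.cast : ℤ → ℝ) * U⁻¹.map Int.cast :=
      Matrix.map_mul (f := Int.castRingHom ℝ)
    rw [← h1, Matrix.mul_nonsing_inv U hU]
    simp
  ext i
  simp only [integerAffineMap, Matrix.add_vecMul, Matrix.vecMul_vecMul, hm, Pi.add_apply,
    Matrix.vecMul_one]
  simp [Matrix.vecMul, dotProduct]

theorem baryLattice_comp {U : Matrix (Fin d) (Fin d) ℤ} (w : Fin d → ℤ) (hU : IsUnit U.det)
    (v : Fin (d + 1) → Fin d → ℝ) :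
    (baryLattice fun i => integerAffineMap U w (v i)) = baryLattice v := by
  refine le_antisymm ?_ (baryLattice_le_comp U w v)
  obtain ⟨U', w', -, h⟩ := exists_inverse_integerAffineMap w hU
  have := baryLattice_le_comp U' w' fun i => integerAffineMap U w (v i)
  simpa only [h] using this

theorem affineIndependent_comp {U : Matrix (Fin d) (Fin d) ℤ} (w : Fin d → ℤ) (hU : IsUnit U.det)
    {v : Fin (d + 1) → Fin d → ℝ} (hv : AffineIndependent ℝ v) :
    AffineIndependent ℝ fun i => integerAffineMap U w (v i) := by
  obtain ⟨U', w', -, h⟩ := exists_inverse_integerAffineMap w hU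
  refine affineIndependent_of_baryMap_injective fun a b hab => baryMap_injective hv ?_
  simp only [baryMap_apply, Prod.mk.injEq] at hab ⊢
  refine ⟨?_, hab.2⟩
  have h1 := integerAffineMap_sum U' w' (fun i => integerAffineMap U w (v i)) a
  have h2 := integerAffineMap_sum U' w' (fun i => integerAffineMap U w (v i)) b
  simp only [h] at h1 h2
  rw [h1, h2, hab.1, hab.2]

theorem image_convexHull_range {ι : Type*} [Fintype ι] (U : Matrix (Fin d) (Fin d) ℤ)
    (w : Fin d → ℤ) (v : ι → Fin d → ℝ) :
    integerAffineMap U w '' convexHull ℝ (Set.range v) =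
      convexHull ℝ (Set.range fun i => integerAffineMap U w (v i)) := by
  ext y
  simp only [Set.mem_image, mem_convexHull_range_iff]
  constructor
  · rintro ⟨_, ⟨a, h0, h1, rfl⟩, rfl⟩
    exact ⟨a, h0, h1, by rw [integerAffineMap_sum, h1, one_smul]; rfl⟩
  · rintro ⟨a, h0, h1, rfl⟩
    exact ⟨_, ⟨a, h0, h1, rfl⟩, by rw [integerAffineMap_sum, h1, one_smul]; rfl⟩

/-- This recovers the vertices, up to order, from the simplex as a set. -/
theorem extremePoints_convexHull_range {v : Fin (d + 1) → Fin d → ℝ} (hv : AffineIndependent ℝ v) :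
    (convexHull ℝ (Set.range v)).extremePoints ℝ = Set.range v := by
  refine Set.Subset.antisymm extremePoints_convexHull_subset ?_
  rintro _ ⟨i, rfl⟩
  refine mem_extremePoints_iff_left.2 ⟨subset_convexHull ℝ _ ⟨i, rfl⟩, ?_⟩
  rintro x hx y hy ⟨s, t, hs, ht, hst, hxy⟩
  obtain ⟨a, ha0, ha1, rfl⟩ := (mem_convexHull_range_iff _ _).1 hx
  obtain ⟨b, hb0, hb1, rfl⟩ := (mem_convexHull_range_iff _ _).1 hy
  have h1 : s • a + t • b = Pi.single i 1 := by
    refine baryMap_injective hv ?_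
    rw [map_add, map_smul, map_smul, baryMap_apply, baryMap_apply, baryMap_apply, ha1, hb1]
    refine Prod.ext ?_ ?_
    · simpa [Pi.single_apply] using hxy
    · simpa using hst
  have h2 : a = Pi.single i 1 := by
    have h3 : ∀ j, j ≠ i → a j = 0 := fun j hj => by
      have h4 := congrFun h1 j
      simp only [Pi.add_apply, Pi.smul_apply, smul_eq_mul, Pi.single_apply, if_neg hj] at h4
      have h5 := mul_nonneg hs.le (ha0 j)
      have h6 := mul_nonneg ht.le (hb0 j)
      have h7 : s * a j = 0 := by linarith
      exact (mul_eq_zero.1 h7).resolve_left hs.ne'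
    have h8 : a i = 1 := by
      rw [← ha1]
      exact (Finset.sum_eq_single i (fun j _ hj => h3 j hj) (by simp)).symm
    funext j
    by_cases hj : j = i
    · subst hj; simpa using h8
    · simp [h3 j hj, hj]
  simp [h2, Pi.single_apply]

theorem exists_perm_of_convexHull_eq {v u : Fin (d + 1) → Fin d → ℝ} (hv : AffineIndependent ℝ v)
    (hu : AffineIndependent ℝ u) (h : convexHull ℝ (Set.range v) = convexHull ℝ (Set.range u)) :
    ∃ E : Fin (d + 1) ≃ Fin (d + 1), ∀ i, v (E i) = u i := by
  have h1 : Set.range v = Set.range u := by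
    rw [← extremePoints_convexHull_range hv, h, extremePoints_convexHull_range hu]
  have h2 : ∀ i, ∃ j, v j = u i := fun i => by
    have : u i ∈ Set.range v := h1 ▸ ⟨i, rfl⟩
    exact this
  choose E hE using h2
  have hinj : Function.Injective E := fun i j hij => hu.injective (by rw [← hE i, ← hE j, hij])
  exact ⟨Equiv.ofBijective E (Finite.injective_iff_bijective.1 hinj), hE⟩

theorem mem_baryLattice_comp_equiv (v : Fin (d + 1) → Fin d → ℝ)
    (E : Fin (d + 1) ≃ Fin (d + 1)) (a : Fin (d + 1) → ℝ) :
    a ∈ baryLattice (v ∘ E) ↔ a ∘ E.symm ∈ baryLattice v := by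
  have h1 : ∑ i, (a ∘ E.symm) i = ∑ i, a i := E.symm.sum_comp a
  have h2 : ∑ i, (a ∘ E.symm) i • v i = ∑ i, a i • (v ∘ E) i := by
    rw [← E.sum_comp]
    simp
  rw [mem_baryLattice, mem_baryLattice, h1, h2]

end LatticePolytope

/-! ### The h*-polynomial as a sum over the unit box. -/

namespace LatticePolytope

variable {d : ℕ}

/-- The injective map `baryMap v` sends these vectors to integer points in a bounded region. -/
theorem finite_baryLattice_bounded {v : Fin (d + 1) → Fin d → ℝ} (hv : AffineIndependent ℝ v)
    (C : ℝ) : {a | a ∈ baryLattice v ∧ ∀ i, 0 ≤ a i ∧ a i ≤ C}.Finite := by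
  let B₁ : Fin d → ℤ := fun c => ⌈∑ i, C * |v i c|⌉
  let B₂ : ℤ := ⌈∑ _i : Fin (d + 1), C⌉
  have hF : ((fun p : (Fin d → ℤ) × ℤ => (((fun c => (p.1 c : ℝ)), (p.2 : ℝ)) :
      (Fin d → ℝ) × ℝ)) '' Set.Icc (-B₁) B₁ ×ˢ Set.Icc (-B₂) B₂).Finite :=
    ((Set.finite_Icc _ _).prod (Set.finite_Icc _ _)).image _
  refine (hF.preimage (f := baryMap v) (baryMap_injective hv).injOn).subset ?_
  rintro a ⟨⟨h1, h2⟩, h3⟩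
  obtain ⟨t, ht⟩ := mem_intSubring.1 h1
  choose z hz using fun c => mem_intSubring.1 (h2 c)
  have hzb : ∀ c, |(z c : ℝ)| ≤ ∑ i, C * |v i c| := fun c => by
    rw [hz, Finset.sum_apply]
    refine (Finset.abs_sum_le_sum_abs _ _).trans (Finset.sum_le_sum fun i _ => ?_)
    rw [Pi.smul_apply, smul_eq_mul, abs_mul, abs_of_nonneg (h3 i).1]
    exact mul_le_mul_of_nonneg_right (h3 i).2 (abs_nonneg _)
  have htb : |(t : ℝ)| ≤ ∑ _i : Fin (d + 1), C := by
    rw [ht, abs_of_nonneg (Finset.sum_nonneg fun i _ => (h3 i).1)]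
    exact Finset.sum_le_sum fun i _ => (h3 i).2
  have hz' : ∀ c, |z c| ≤ ⌈∑ i, C * |v i c|⌉ := fun c => by
    have := (hzb c).trans (Int.le_ceil _)
    exact_mod_cast this
  have ht' : |t| ≤ ⌈∑ _i : Fin (d + 1), C⌉ := by
    have := htb.trans (Int.le_ceil _)
    exact_mod_cast this
  refine ⟨(z, t), ⟨⟨fun c => ?_, fun c => ?_⟩, ⟨?_, ?_⟩⟩, ?_⟩
  · exact (abs_le.1 (hz' c)).1
  · exact (abs_le.1 (hz' c)).2
  · exact (abs_le.1 ht').1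
  · exact (abs_le.1 ht').2
  · exact Prod.ext (funext hz) ht

theorem finite_unitBox {v : Fin (d + 1) → Fin d → ℝ} (hv : AffineIndependent ℝ v) :
    (unitBox (baryLattice v)).Finite :=
  (finite_baryLattice_bounded hv 1).subset fun _ ha => ⟨ha.1, fun i => ⟨(ha.2 i).1, (ha.2 i).2.le⟩⟩

/-- The nonnegative vectors of a subgroup with coordinate sum `m`. -/
def levelSet {ι : Type*} [Fintype ι] (L : AddSubgroup (ι → ℝ)) (m : ℕ) : Set (ι → ℝ) :=
  {a | a ∈ L ∧ (∀ i, 0 ≤ a i) ∧ ∑ i, a i = m}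

theorem finite_levelSet {v : Fin (d + 1) → Fin d → ℝ} (hv : AffineIndependent ℝ v) (m : ℕ) :
    (levelSet (baryLattice v) m).Finite :=
  (finite_baryLattice_bounded hv m).subset fun _ ha => ⟨ha.1, fun i => ⟨ha.2.1 i, by
    rw [← ha.2.2]; exact Finset.single_le_sum (fun i _ => ha.2.1 i) (Finset.mem_univ i)⟩⟩

theorem latticePointCount_eq {v : Fin (d + 1) → Fin d → ℝ} (hv : AffineIndependent ℝ v) (m : ℕ) :
    latticePointCount (convexHull ℝ (Set.range v)) m = (levelSet (baryLattice v) m).ncard := by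
  have h : ((m : ℝ) • convexHull ℝ (Set.range v)) ∩ integerPoints d =
      (fun a : Fin (d + 1) → ℝ => ∑ i, a i • v i) '' levelSet (baryLattice v) m := by
    ext x
    constructor
    · rintro ⟨⟨y, hy, rfl⟩, hx⟩
      obtain ⟨a, ha0, ha1, rfl⟩ := (mem_convexHull_range_iff _ _).1 hy
      have h1 : ∑ i, ((m : ℝ) • a) i • v i = (m : ℝ) • ∑ i, a i • v i := by
        simp [Finset.smul_sum, mul_smul]
      have h2 : ∑ i, ((m : ℝ) • a) i = m := by
        simp only [Pi.smul_apply, smul_eq_mul]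
        rw [← Finset.mul_sum, ha1, mul_one]
      refine ⟨(m : ℝ) • a, ⟨⟨by rw [h2]; exact natCast_mem _ _, ?_⟩, fun i => ?_, h2⟩, h1⟩
      · rw [h1]; exact mem_integerPoints.1 hx
      · have := ha0 i
        simp only [Pi.smul_apply, smul_eq_mul]
        positivity
    · rintro ⟨a, ⟨ha, ha0, ha1⟩, rfl⟩
      refine ⟨?_, mem_integerPoints.2 ha.2⟩
      rcases Nat.eq_zero_or_pos m with rfl | hm
      · have h1 : ∀ i, a i = 0 := fun i =>
          (Finset.sum_eq_zero_iff_of_nonneg fun i _ => ha0 i).1 (by simpa using ha1) i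
            (Finset.mem_univ i)
        exact ⟨v 0, subset_convexHull ℝ _ ⟨0, rfl⟩, by simp [h1]⟩
      · have hm' : (m : ℝ) ≠ 0 := by positivity
        refine ⟨∑ i, (a i / m) • v i, (mem_convexHull_range_iff _ _).2
          ⟨fun i => a i / m, fun i => ?_, ?_, rfl⟩, ?_⟩
        · have := ha0 i; positivity
        · rw [← Finset.sum_div, ha1, div_self hm']
        · simp only [Finset.smul_sum, smul_smul]
          exact Finset.sum_congr rfl fun i _ => by rw [mul_div_cancel₀ _ hm']
  rw [latticePointCount, h, Set.InjOn.ncard_image]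
  rintro a ⟨-, -, ha⟩ b ⟨-, -, hb⟩ hab
  exact baryMap_injective hv (Prod.ext hab (ha.trans hb.symm))

theorem exists_height {ι : Type*} [Fintype ι] {a : ι → ℝ} (h0 : ∀ i, 0 ≤ a i)
    (h1 : ∑ i, a i ∈ intSubring) : ∃ m : ℕ, ∑ i, a i = m := by
  obtain ⟨m, hm⟩ := exists_nat_of_mem_intSubring h1
    (by linarith [Finset.sum_nonneg fun i (_ : i ∈ Finset.univ) => h0 i])
  exact ⟨m, hm.symm⟩

/-- The coordinate sum, rounded down to a natural number. -/
noncomputable def height {ι : Type*} [Fintype ι] (a : ι → ℝ) : ℕ := ⌊∑ i, a i⌋₊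

theorem height_spec {v : Fin (d + 1) → Fin d → ℝ} {a : Fin (d + 1) → ℝ}
    (ha : a ∈ unitBox (baryLattice v)) : ∑ i, a i = height a := by
  obtain ⟨m, hm⟩ := exists_height (fun i => (ha.2 i).1) ha.1.1
  rw [height, hm, Nat.floor_natCast]

/-- A nonnegative vector splits uniquely into its fractional part, a box element `b`, and a vector
of natural numbers with sum `m - height b`. -/
theorem ncard_levelSet {v : Fin (d + 1) → Fin d → ℝ} (hv : AffineIndependent ℝ v)
    (hvi : ∀ j, v j ∈ integerPoints d) (m : ℕ) :
    (levelSet (baryLattice v) m).ncard = ∑ b ∈ (finite_unitBox hv).toFinset,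
      if height b ≤ m then
        (Finset.finsuppAntidiag (Finset.univ : Finset (Fin (d + 1))) (m - height b)).card
      else 0 := by
  classical
  rw [Set.ncard_eq_toFinset_card _ (finite_levelSet hv m)]
  rw [Finset.card_eq_sum_card_fiberwise (f := fun a i => Int.fract (a i))
    (t := (finite_unitBox hv).toFinset)]
  swap
  · intro a ha
    simp only [Set.Finite.coe_toFinset] at ha ⊢
    exact fract_mem_unitBox (fun a => intSubring_mem_baryLattice hvi) ha.1
  refine Finset.sum_congr rfl fun b hb => ?_
  rw [Set.Finite.mem_toFinset] at hb
  have hbs := height_spec hb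
  have hfl : ∀ a : Fin (d + 1) → ℝ, (∀ i, 0 ≤ a i) → (fun i => Int.fract (a i)) = b →
      ∀ i, a i = b i + (⌊a i⌋₊ : ℝ) := by
    intro a ha hab i
    rw [← hab, natCast_floor_eq_intCast_floor (ha i), Int.fract_add_floor]
  have hsum : ∀ a ∈ levelSet (baryLattice v) m, (fun i => Int.fract (a i)) = b →
      m = height b + ∑ i, ⌊a i⌋₊ := by
    rintro a ⟨-, ha0, ha1⟩ hab
    rw [Finset.sum_congr rfl fun i _ => hfl a ha0 hab i, Finset.sum_add_distrib, hbs] at ha1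
    exact_mod_cast ha1.symm
  split_ifs with hle
  · refine Finset.card_nbij' (fun a => Finsupp.equivFunOnFinite.symm fun i => ⌊a i⌋₊)
      (fun c i => b i + c i) ?_ ?_ ?_ ?_
    · intro a ha
      simp only [Finset.coe_filter, Set.Finite.mem_toFinset, Set.mem_ofPred_eq] at ha
      have := hsum a ha.1 ha.2
      simp [Finset.mem_finsuppAntidiag]
      omega
    · intro c hc
      simp only [Finset.mem_coe, Finset.mem_finsuppAntidiag] at hc
      simp only [Finset.coe_filter, Set.Finite.mem_toFinset, Set.mem_ofPred_eq]
      refine ⟨⟨?_, fun i => ?_, ?_⟩, ?_⟩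
      · exact (baryLattice v).add_mem hb.1
          (intSubring_mem_baryLattice (a := fun i => (c i : ℝ)) hvi fun i => natCast_mem _ _)
      · have := (hb.2 i).1; positivity
      · rw [Finset.sum_add_distrib, hbs]
        have h1 : ∑ i, c i = m - height b := hc.1
        have h2 : height b + ∑ i, c i = m := by omega
        exact_mod_cast h2
      · funext i
        rw [Int.fract_add_natCast]
        exact Int.fract_eq_self.2 (hb.2 i)
    · intro a ha
      simp only [Finset.coe_filter, Set.Finite.mem_toFinset, Set.mem_ofPred_eq] at ha
      funext i
      simp only [Finsupp.equivFunOnFinite_symm_apply_apply]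
      exact (hfl a ha.1.2.1 ha.2 i).symm
    · intro c hc
      ext i
      simp only [Finsupp.equivFunOnFinite_symm_apply_apply]
      rw [Nat.floor_add_natCast (hb.2 i).1, Nat.floor_eq_zero.2 (hb.2 i).2, zero_add]
  · rw [Finset.card_eq_zero, Finset.filter_eq_empty_iff]
    intro a ha hab
    rw [Set.Finite.mem_toFinset] at ha
    have := hsum a ha hab
    omega

/-- Each box element contributes `X ^ height` times the generating series of `ℕ^(d+1)`, which is the
inverse of `(1 - X) ^ (d + 1)`. -/
theorem hStar_eq {v : Fin (d + 1) → Fin d → ℝ} (hv : AffineIndependent ℝ v)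
    (hvi : ∀ j, v j ∈ integerPoints d) :
    (1 - PowerSeries.X) ^ (d + 1) * ehrhartSeries (convexHull ℝ (Set.range v)) =
      ∑ b ∈ (finite_unitBox hv).toFinset, (PowerSeries.X : PowerSeries ℤ) ^ height b := by
  have h1 : ehrhartSeries (convexHull ℝ (Set.range v)) =
      (∑ b ∈ (finite_unitBox hv).toFinset, (PowerSeries.X : PowerSeries ℤ) ^ height b) *
        ∏ _i : Fin (d + 1), PowerSeries.mk 1 := by
    ext m
    have h2 : PowerSeries.coeff m (ehrhartSeries (convexHull ℝ (Set.range v))) =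
        ((levelSet (baryLattice v) m).ncard : ℤ) := by
      rw [ehrhartSeries, PowerSeries.coeff_mk]
      split_ifs with hm
      · subst hm
        have h3 : levelSet (baryLattice v) 0 = {0} := by
          ext a
          constructor
          · rintro ⟨-, h0, h1⟩
            funext i
            exact (Finset.sum_eq_zero_iff_of_nonneg fun i _ => h0 i).1 (by simpa using h1) i
              (Finset.mem_univ i)
          · rintro rfl
            exact ⟨zero_mem _, by simp, by simp⟩
        rw [h3, Set.ncard_singleton]
        rfl
      · rw [latticePointCount_eq hv]
    rw [h2, ncard_levelSet hv hvi, Finset.sum_mul, map_sum, Nat.cast_sum]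
    refine Finset.sum_congr rfl fun b _ => ?_
    rw [PowerSeries.coeff_X_pow_mul']
    split_ifs
    · rw [PowerSeries.coeff_prod]
      simp
    · rfl
  rw [h1, mul_left_comm, Finset.prod_const, Finset.card_univ, Fintype.card_fin, ← mul_pow,
    mul_comm (1 - PowerSeries.X), PowerSeries.mk_one_mul_one_sub_eq_one, one_pow, mul_one]

/-- Coefficients are compared: one side counts box elements of height `m`, the other the `M < N`
with `M * k = m`, of which there is at most one since `k ≥ 1`. -/
theorem hasHStarPolynomial_blockPolynomial_iff {v : Fin (d + 1) → Fin d → ℝ}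
    (hv : AffineIndependent ℝ v) (hvi : ∀ j, v j ∈ integerPoints d) {N k : ℕ} (hk : 1 ≤ k) :
    HasHStarPolynomial (convexHull ℝ (Set.range v)) (blockPolynomial N k) ↔
      HasBlockHeights (baryLattice v) N k := by
  classical
  have hk' : (k : ℝ) ≠ 0 := by positivity
  have hkm : ∀ {M M' : ℕ}, M * k = M' * k ↔ M = M' := by
    intro M M'
    exact Nat.mul_left_inj (by omega)
  have hblock : ∀ m, PowerSeries.coeff m (blockPolynomial N k : PowerSeries ℤ) =
      ((Finset.range N).filter fun M => M * k = m).card := by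
    intro m
    simp [blockPolynomial, Polynomial.coeff_X_pow, eq_comm]
  have hbox : ∀ m, PowerSeries.coeff m (∑ b ∈ (finite_unitBox hv).toFinset,
      (PowerSeries.X : PowerSeries ℤ) ^ height b) =
        ((finite_unitBox hv).toFinset.filter fun b => height b = m).card := by
    intro m
    simp [PowerSeries.coeff_X_pow, eq_comm]
  have hmem : ∀ b M, b ∈ (finite_unitBox hv).toFinset.filter (fun b => height b = M * k) ↔
      b ∈ unitBox (baryLattice v) ∧ ∑ i, b i = k * M := by
    intro b M
    rw [Finset.mem_filter, Set.Finite.mem_toFinset]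
    refine and_congr_right fun hb => ?_
    rw [height_spec hb, mul_comm]
    norm_cast
  rw [HasHStarPolynomial, hStar_eq hv hvi, PowerSeries.ext_iff]
  simp only [hblock, hbox, Nat.cast_inj]
  have hone : ∀ M < N, ((Finset.range N).filter fun M' => M' * k = M * k).card = 1 := by
    intro M hM
    rw [Finset.card_eq_one]
    exact ⟨M, by ext M'; simp only [Finset.mem_filter, Finset.mem_range, Finset.mem_singleton, hkm]
                 constructor
                 · exact fun h => h.2
                 · rintro rfl; exact ⟨hM, rfl⟩⟩
  constructor
  · intro h
    refine ⟨fun M hM => ?_, fun b hb => ?_⟩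
    · have h1 := h (M * k)
      rw [hone M hM] at h1
      obtain ⟨b, hb⟩ := Finset.card_eq_one.1 h1.symm
      have hb' : ∀ c, (c ∈ unitBox (baryLattice v) ∧ ∑ i, c i = k * M) ↔ c = b := fun c => by
        rw [← hmem, hb, Finset.mem_singleton]
      exact ⟨b, (hb' b).2 rfl, fun c hc => (hb' c).1 hc⟩
    · have h1 := h (height b)
      have h2 : 0 < ((Finset.range N).filter fun M => M * k = height b).card := by
        rw [h1]
        exact Finset.card_pos.2 ⟨b, by simp [hb]⟩
      obtain ⟨M, hM⟩ := Finset.card_pos.1 h2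
      rw [Finset.mem_filter, Finset.mem_range] at hM
      refine ⟨M, hM.1, ?_⟩
      rw [height_spec hb, ← hM.2]
      push_cast
      ring
  · rintro ⟨h1, h2⟩ m
    by_cases hm : ∃ M < N, M * k = m
    · obtain ⟨M, hM, rfl⟩ := hm
      rw [hone M hM, eq_comm, Finset.card_eq_one]
      obtain ⟨b, hb, hbu⟩ := h1 M hM
      refine ⟨b, ?_⟩
      ext c
      rw [hmem, Finset.mem_singleton]
      exact ⟨hbu c, fun h => h ▸ hb⟩
    · push Not at hm
      have e1 : ((Finset.range N).filter fun M => M * k = m) = ∅ :=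
        Finset.filter_eq_empty_iff.2 fun M hM => hm M (Finset.mem_range.1 hM)
      have e2 : ((finite_unitBox hv).toFinset.filter fun b => height b = m) = ∅ := by
        refine Finset.filter_eq_empty_iff.2 fun b hb hbm => ?_
        rw [Set.Finite.mem_toFinset] at hb
        obtain ⟨M, hM, hMs⟩ := h2 b hb
        rw [height_spec hb, hbm] at hMs
        exact hm M hM (by rw [mul_comm]; exact_mod_cast hMs.symm)
      rw [e1, e2]
      rfl

end LatticePolytope

/-! ### Realising lattices by simplices. -/

namespace LatticePolytope

theorem floor_of_mem_intSubring {r : ℝ} (h : r ∈ intSubring) : (⌊r⌋ : ℝ) = r := by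
  obtain ⟨z, rfl⟩ := mem_intSubring.1 h
  simp

theorem exists_mul_mem_intSubring {ι : Type*} {L : AddSubgroup (ι → ℝ)}
    (hZ : ∀ a : ι → ℝ, (∀ i, a i ∈ intSubring) → a ∈ L) (hfin : (unitBox L).Finite) :
    ∃ N : ℕ, 0 < N ∧ ∀ a ∈ L, ∀ i, N * a i ∈ intSubring := by
  classical
  -- If the box has `c` elements, two of the multiples `0, …, c` of `a` agree modulo integers, and
  -- the difference of their indices divides `c!`.
  refine ⟨(hfin.toFinset.card).factorial, Nat.factorial_pos _, fun a ha i => ?_⟩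
  have hb : ∀ q : ℕ, (fun i => Int.fract ((q • a) i)) ∈ unitBox L := fun q =>
    fract_mem_unitBox hZ (L.nsmul_mem ha q)
  obtain ⟨q₁, h₁, q₂, h₂, hne, heq⟩ := Finset.exists_ne_map_eq_of_card_lt_of_maps_to
    (s := Finset.range (hfin.toFinset.card + 1)) (t := hfin.toFinset)
    (f := fun q i => Int.fract ((q • a) i)) (by simp) (fun q _ => by simpa using hb q)
  wlog hlt : q₁ < q₂ generalizing q₁ q₂
  · exact this q₂ h₂ q₁ h₁ hne.symm heq.symm (by omega)
  have h3 : ((q₂ - q₁ : ℕ) : ℝ) * a i ∈ intSubring := by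
    have h4 : Int.fract ((q₁ • a) i) = Int.fract ((q₂ • a) i) := congrFun heq i
    have := intSubring.sub_mem (sub_fract_mem_intSubring ((q₂ • a) i))
      (sub_fract_mem_intSubring ((q₁ • a) i))
    rw [h4] at this
    convert this using 1
    simp only [nsmul_pi_apply, Nat.cast_sub hlt.le]
    ring
  rw [Finset.mem_range] at h₂
  obtain ⟨c, hc⟩ := Nat.dvd_factorial (m := q₂ - q₁) (n := hfin.toFinset.card)
    (by omega) (by omega)
  rw [hc, Nat.cast_mul, mul_comm ((q₂ - q₁ : ℕ) : ℝ), mul_assoc]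
  exact intSubring.mul_mem (natCast_mem _ _) h3

variable {d : ℕ}

/-- The first coordinate is determined by the others, so `K` embeds into `ℤ^d` by `ψ` and contains a
copy of `ℤ^d` by `χ`; hence it is free of rank `d`. -/
theorem exists_basis_sum_zero {L : AddSubgroup (Fin (d + 1) → ℝ)}
    (hZ : ∀ a : Fin (d + 1) → ℝ, (∀ i, a i ∈ intSubring) → a ∈ L) {N : ℕ} (hN : 0 < N)
    (hLN : ∀ a ∈ L, ∀ i, N * a i ∈ intSubring) (K : Submodule ℤ (Fin (d + 1) → ℝ))
    (hK : ∀ a, a ∈ K ↔ a ∈ L ∧ ∑ i, a i = 0) : Nonempty (Module.Basis (Fin d) ℤ K) := by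
  have hN' : (N : ℝ) ≠ 0 := by positivity
  have hint : ∀ a : K, ∀ i, (⌊N * a.1 i⌋ : ℝ) = N * a.1 i := fun a i =>
    floor_of_mem_intSubring (hLN _ ((hK _).1 a.2).1 i)
  let ψ : K →ₗ[ℤ] (Fin d → ℤ) :=
    { toFun := fun a j => ⌊N * a.1 j.succ⌋
      map_add' := fun a b => by
        funext j
        apply Int.cast_injective (α := ℝ)
        simp only [Pi.add_apply, Int.cast_add, hint]
        simp only [Submodule.coe_add, Pi.add_apply]
        ring
      map_smul' := fun c a => by
        funext j
        apply Int.cast_injective (α := ℝ)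
        simp only [RingHom.id_apply, Pi.smul_apply, smul_eq_mul, Int.cast_mul, hint]
        simp only [Submodule.coe_smul, Pi.smul_apply, zsmul_eq_mul]
        ring }
  have hψ : Function.Injective ψ := by
    rw [← LinearMap.ker_eq_bot, LinearMap.ker_eq_bot']
    intro a ha
    have h1 : ∀ j : Fin d, a.1 j.succ = 0 := fun j => by
      have h2 := hint a j.succ
      have h3 : ⌊N * a.1 j.succ⌋ = 0 := congrFun ha j
      rw [h3, Int.cast_zero, eq_comm] at h2
      exact (mul_eq_zero.1 h2).resolve_left hN'
    have h4 := ((hK _).1 a.2).2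
    rw [Fin.sum_univ_succ] at h4
    simp only [h1, Finset.sum_const_zero, add_zero] at h4
    ext i
    refine Fin.cases ?_ (fun j => ?_) i
    · simpa using h4
    · simpa using h1 j
  let χ : (Fin d → ℤ) →ₗ[ℤ] (Fin (d + 1) → ℝ) :=
    { toFun := fun z => Fin.cons (-∑ j, (z j : ℝ)) fun j => (z j : ℝ)
      map_add' := fun a b => by
        funext i
        refine Fin.cases ?_ (fun j => ?_) i
        · simp [Finset.sum_add_distrib]; ring
        · simp
      map_smul' := fun c a => by
        funext i
        refine Fin.cases ?_ (fun j => ?_) i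
        · simp [Finset.mul_sum]
        · simp }
  have hχ : ∀ z, χ z ∈ K := fun z => by
    rw [hK]
    refine ⟨hZ _ fun i => ?_, ?_⟩
    · refine Fin.cases ?_ (fun j => ?_) i
      · exact intSubring.neg_mem (intSubring.sum_mem fun j _ => intCast_mem _ _)
      · exact intCast_mem intSubring (z j)
    · simp [χ, Fin.sum_univ_succ]
  have hχi : Function.Injective (χ.codRestrict K hχ) := by
    intro z z' h
    have h1 : χ z = χ z' := congrArg Subtype.val h
    funext j
    have h2 := congrFun h1 j.succ
    simpa [χ] using h2
  have : Module.Finite ℤ K := Module.Finite.of_injective ψ hψ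
  have hrank : Module.finrank ℤ K = d := by
    have h1 := LinearMap.finrank_le_finrank_of_injective hψ
    have h2 := LinearMap.finrank_le_finrank_of_injective hχi
    simp only [Module.finrank_fin_fun] at h1 h2
    omega
  have : Module.Free ℤ K := Module.Free.of_equiv (LinearEquiv.ofInjective ψ hψ).symm
  exact ⟨Module.finBasisOfFinrankEq ℤ K hrank⟩

/-- Every lattice between `ℤ^(d+1)` and a multiple `(1 / N) ℤ^(d+1)` with integral coordinate sums
is the lattice of barycentric coordinates of a lattice simplex. -/
theorem exists_baryLattice_eq {L : AddSubgroup (Fin (d + 1) → ℝ)}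
    (hZ : ∀ a : Fin (d + 1) → ℝ, (∀ i, a i ∈ intSubring) → a ∈ L) {N : ℕ} (hN : 0 < N)
    (hLN : ∀ a ∈ L, ∀ i, N * a i ∈ intSubring) (hs : ∀ a ∈ L, ∑ i, a i ∈ intSubring) :
    ∃ v : Fin (d + 1) → Fin d → ℝ, (∀ j, v j ∈ integerPoints d) ∧ AffineIndependent ℝ v ∧
      baryLattice v = L := by
  let K : Submodule ℤ (Fin (d + 1) → ℝ) :=
    { carrier := {a | a ∈ L ∧ ∑ i, a i = 0}
      add_mem' := fun {a b} ha hb => ⟨L.add_mem ha.1 hb.1, by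
        simp [Finset.sum_add_distrib, ha.2, hb.2]⟩
      zero_mem' := ⟨L.zero_mem, by simp⟩
      smul_mem' := fun c a ha => ⟨L.zsmul_mem ha.1 c, by simp [← Finset.mul_sum, ha.2]⟩ }
  have hK : ∀ a, a ∈ K ↔ a ∈ L ∧ ∑ i, a i = 0 := fun a => Iff.rfl
  obtain ⟨b⟩ := exists_basis_sum_zero hZ hN hLN K hK
  let ε : Fin (d + 1) → Fin (d + 1) → ℝ := fun i => Pi.single i 1
  have hεL : ∀ i, ε i ∈ L := fun i => hZ _ fun j => by
    simp only [ε, Pi.single_apply]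
    split_ifs
    · exact intSubring.one_mem
    · exact intSubring.zero_mem
  have hεs : ∀ i, ∑ j, ε i j = 1 := fun i => by simp [ε]
  have hεK : ∀ i, ε i - ε 0 ∈ K := fun i =>
    ⟨L.sub_mem (hεL i) (hεL 0), by simp [Finset.sum_sub_distrib, hεs]⟩
  -- The vertices are the coordinates of `ε i - ε 0` in the basis of `K`; vertex `0` is the origin.
  let V : Fin (d + 1) → Fin d → ℤ := fun i j => b.repr ⟨_, hεK i⟩ j
  have hexp : ∀ k : K, k.1 = ∑ j, ((b.repr k j : ℤ) : ℝ) • (b j).1 := fun k => by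
    conv_lhs => rw [← b.sum_repr k]
    rw [Submodule.coe_sum]
    exact Finset.sum_congr rfl fun j _ => by rw [Submodule.coe_smul, Int.cast_smul_eq_zsmul]
  let v : Fin (d + 1) → Fin d → ℝ := fun i j => V i j
  have hε : ∀ i, ε i = ε 0 + ∑ j, v i j • (b j).1 := fun i => by
    have := hexp ⟨_, hεK i⟩
    rw [← sub_eq_iff_eq_add', ← this]
  -- The inverse of `baryMap v`. It carries `ℤ^d × ℤ` onto `L`, because integral coordinate sums
  -- split `L` as `ℤ ε 0 ⊕ K`.
  let Ψ : (Fin d → ℝ) × ℝ → Fin (d + 1) → ℝ := fun y => y.2 • ε 0 + ∑ j, y.1 j • (b j).1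
  have hΨ : ∀ a, Ψ (baryMap v a) = a := fun a => by
    have h1 : a = ∑ i, a i • ε i := by
      funext j
      simp [ε, Finset.sum_apply, Pi.single_apply]
    have h2 : ∑ i, a i • ε i = ∑ i, a i • (ε 0 + ∑ j, v i j • (b j).1) :=
      Finset.sum_congr rfl fun i _ => congrArg (a i • ·) (hε i)
    conv_rhs => rw [h1, h2]
    simp only [Ψ, baryMap_apply, Finset.sum_apply, Pi.smul_apply, smul_eq_mul]
    simp only [smul_add, Finset.sum_add_distrib, Finset.sum_smul, Finset.smul_sum, smul_smul]
    rw [Finset.sum_comm]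
  have hinj : Function.Injective (baryMap v) := Function.LeftInverse.injective hΨ
  have hv := affineIndependent_of_baryMap_injective hinj
  have hΨ' : ∀ y, baryMap v (Ψ y) = y := fun y => by
    obtain ⟨a, rfl⟩ := (baryEquiv hv).surjective y
    change baryMap v (Ψ (baryMap v a)) = baryMap v a
    rw [hΨ]
  refine ⟨v, fun j => ⟨V j, rfl⟩, hv, ?_⟩
  ext a
  constructor
  · rintro ⟨h1, h2⟩
    obtain ⟨t, ht⟩ := mem_intSubring.1 h1
    choose z hz using fun c => mem_intSubring.1 (h2 c)
    have h3 : Ψ (fun c => z c, t) ∈ L := by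
      refine L.add_mem ?_ (L.sum_mem fun j _ => ?_)
      · rw [Int.cast_smul_eq_zsmul]; exact L.zsmul_mem (hεL 0) t
      · rw [Int.cast_smul_eq_zsmul]; exact L.zsmul_mem (b j).2.1 (z j)
    have h4 : ((fun c => (z c : ℝ)), (t : ℝ)) = baryMap v a := Prod.ext (funext hz) ht
    rwa [h4, hΨ] at h3
  · intro ha
    obtain ⟨t, ht⟩ := mem_intSubring.1 (hs a ha)
    have h1 : a - (t : ℝ) • ε 0 ∈ K := by
      refine ⟨L.sub_mem ha (by rw [Int.cast_smul_eq_zsmul]; exact L.zsmul_mem (hεL 0) t), ?_⟩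
      simp only [Pi.sub_apply, Pi.smul_apply, smul_eq_mul, Finset.sum_sub_distrib]
      rw [← Finset.mul_sum, hεs, ht]
      ring
    have h2 := hexp ⟨_, h1⟩
    have h3 : a = Ψ (fun j => (b.repr ⟨_, h1⟩ j : ℝ), t) := by
      simp only [Ψ]
      rw [← h2]
      simp
    have h4 : baryMap v a = (fun j => (b.repr ⟨_, h1⟩ j : ℝ), (t : ℝ)) := by
      conv_lhs => rw [h3]
      exact hΨ' _
    rw [baryMap_apply, Prod.mk.injEq] at h4
    exact ⟨hs a ha, fun c => by rw [h4.1]; exact intCast_mem intSubring _⟩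

/-! ### Pyramids. -/

/-- The vertices of the pyramid over a simplex. -/
noncomputable def pyramidVertices (w : Fin (d + 1) → Fin d → ℝ) :
    Fin (d + 1 + 1) → Fin (d + 1) → ℝ :=
  Fin.snoc (α := fun _ => Fin (d + 1) → ℝ) (fun j => Fin.snoc (α := fun _ => ℝ) (w j) 0)
    (Fin.snoc (α := fun _ => ℝ) 0 1)

theorem sum_pyramidVertices (w : Fin (d + 1) → Fin d → ℝ) (a : Fin (d + 1 + 1) → ℝ) :
    ∑ i, a i • pyramidVertices w i =
      Fin.snoc (α := fun _ => ℝ) (∑ j : Fin (d + 1), a j.castSucc • w j) (a (Fin.last _)) := by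
  rw [Fin.sum_univ_castSucc]
  simp only [pyramidVertices, Fin.snoc_castSucc, Fin.snoc_last]
  funext c
  refine Fin.lastCases ?_ (fun c => ?_) c
  · simp
  · simp

theorem pyramid_convexHull (w : Fin (d + 1) → Fin d → ℝ) :
    pyramid (convexHull ℝ (Set.range w)) = convexHull ℝ (Set.range (pyramidVertices w)) := by
  let f : (Fin d → ℝ) →ₗ[ℝ] (Fin (d + 1) → ℝ) :=
    { toFun := fun x => Fin.snoc (α := fun _ => ℝ) x 0
      map_add' := fun x y => by
        funext c
        refine Fin.lastCases ?_ (fun c => ?_) c <;> simp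
      map_smul' := fun t x => by
        funext c
        refine Fin.lastCases ?_ (fun c => ?_) c <;> simp }
  have h1 : Set.range (pyramidVertices w) =
      f '' Set.range w ∪ {Fin.snoc (α := fun _ => ℝ) 0 1} := by
    ext x
    constructor
    · rintro ⟨i, rfl⟩
      refine Fin.lastCases ?_ (fun j => ?_) i
      · right; simp [pyramidVertices]
      · left; exact ⟨w j, ⟨j, rfl⟩, by simp [pyramidVertices, f]⟩
    · rintro (⟨_, ⟨j, rfl⟩, rfl⟩ | rfl)
      · exact ⟨j.castSucc, by simp [pyramidVertices, f]⟩
      · exact ⟨Fin.last _, by simp [pyramidVertices]⟩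
  rw [h1, ← convexHull_convexHull_union_left, ← f.image_convexHull]
  rfl

/-- An integral coordinate splits off a summand `ℤ`; the remaining coordinates form the lattice of a
simplex of one dimension less, which serves as the base. -/
theorem isLatticePyramid_of_forall_mem_intSubring {v : Fin (d + 1 + 1) → Fin (d + 1) → ℝ}
    (hv : AffineIndependent ℝ v) (hvi : ∀ j, v j ∈ integerPoints (d + 1)) {i₀ : Fin (d + 1 + 1)}
    (h : ∀ a ∈ baryLattice v, a i₀ ∈ intSubring) :
    IsLatticePyramid (convexHull ℝ (Set.range v)) := by
  wlog hi : i₀ = Fin.last _ generalizing v i₀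
  · let E := Equiv.swap i₀ (Fin.last (d + 1))
    have h1 := this (v := v ∘ E) (hv.comp_embedding E.toEmbedding) (fun j => hvi _)
      (i₀ := Fin.last _) (fun a ha => by
        have := h _ ((mem_baryLattice_comp_equiv v E a).1 ha)
        simpa [E] using this) rfl
    rwa [E.surjective.range_comp] at h1
  subst hi
  let σ : (Fin (d + 1) → ℝ) →+ (Fin (d + 1 + 1) → ℝ) :=
    { toFun := fun x => Fin.snoc (α := fun _ => ℝ) x 0
      map_zero' := by
        funext c
        refine Fin.lastCases ?_ (fun c => ?_) c <;> simp
      map_add' := fun x y => by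
        funext c
        refine Fin.lastCases ?_ (fun c => ?_) c <;> simp }
  have hσc : ∀ x (j : Fin (d + 1)), σ x j.castSucc = x j := fun x j => by simp [σ]
  have hσl : ∀ x, σ x (Fin.last _) = 0 := fun x => by simp [σ]
  obtain ⟨N, hN, hLN⟩ := exists_mul_mem_intSubring (L := baryLattice v)
    (fun a => intSubring_mem_baryLattice hvi) (finite_unitBox hv)
  obtain ⟨w, hwi, hw, hwL⟩ := exists_baryLattice_eq (L := (baryLattice v).comap σ)
    (fun a ha => intSubring_mem_baryLattice hvi fun i => by
      refine Fin.lastCases ?_ (fun j => ?_) i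
      · rw [hσl]; exact intSubring.zero_mem
      · rw [hσc]; exact ha j) hN
    (fun a ha j => by have := hLN _ ha j.castSucc; rwa [hσc] at this)
    (fun a ha => by
      have h1 : ∑ i, σ a i ∈ intSubring := ha.1
      rw [Fin.sum_univ_castSucc] at h1
      simpa only [hσc, hσl, add_zero] using h1)
  refine ⟨convexHull ℝ (Set.range w), ⟨Set.range w, Set.finite_range w, Set.range_nonempty w,
    by rintro _ ⟨j, rfl⟩; exact hwi j, rfl⟩, ?_⟩
  rw [pyramid_convexHull]
  refine unimodularlyEquivalent_of_baryLattice_eq ?_ hv ?_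
  · refine affineIndependent_of_baryMap_injective fun a b hab => ?_
    rw [baryMap_apply, baryMap_apply, Prod.mk.injEq, sum_pyramidVertices, sum_pyramidVertices] at hab
    have hl : a (Fin.last _) = b (Fin.last _) := by simpa using congrFun hab.1 (Fin.last _)
    have hc : (fun j : Fin (d + 1) => a j.castSucc) = fun j => b j.castSucc := by
      refine baryMap_injective hw (Prod.ext ?_ ?_)
      · funext c
        have := congrFun hab.1 c.castSucc
        simp only [Fin.snoc_castSucc] at this
        exact this
      · have := hab.2
        rw [Fin.sum_univ_castSucc, Fin.sum_univ_castSucc b, hl] at this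
        exact add_right_cancel this
    funext i
    refine Fin.lastCases hl (fun j => ?_) i
    exact congrFun hc j
  · ext a
    have hdec : a - σ (fun j => a j.castSucc) = Pi.single (Fin.last _) (a (Fin.last _)) := by
      funext i
      refine Fin.lastCases ?_ (fun j => ?_) i
      · simp [hσl]
      · simp [hσc]
    have hpyr : a ∈ baryLattice (pyramidVertices w) ↔
        a (Fin.last _) ∈ intSubring ∧ (fun j : Fin (d + 1) => a j.castSucc) ∈ baryLattice w := by
      rw [mem_baryLattice, mem_baryLattice, sum_pyramidVertices, Fin.sum_univ_castSucc]
      constructor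
      · rintro ⟨h1, h2⟩
        have h3 : a (Fin.last _) ∈ intSubring := by simpa only [Fin.snoc_last] using h2 (Fin.last _)
        refine ⟨h3, ?_, fun c => by simpa only [Fin.snoc_castSucc] using h2 c.castSucc⟩
        have := intSubring.sub_mem h1 h3
        rwa [add_sub_cancel_right] at this
      · rintro ⟨h1, h2, h3⟩
        refine ⟨intSubring.add_mem h2 h1, fun c => ?_⟩
        refine Fin.lastCases ?_ (fun c => ?_) c
        · rwa [Fin.snoc_last]
        · rw [Fin.snoc_castSucc]; exact h3 c
    have hiff : a (Fin.last _) ∈ intSubring →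
        (σ (fun j => a j.castSucc) ∈ baryLattice v ↔ a ∈ baryLattice v) := by
      intro hl
      have h1 : a - σ (fun j => a j.castSucc) ∈ baryLattice v := by
        rw [hdec]
        refine intSubring_mem_baryLattice hvi fun i => ?_
        rw [Pi.single_apply]
        split_ifs
        · exact hl
        · exact intSubring.zero_mem
      constructor
      · intro h2
        have := (baryLattice v).add_mem h1 h2
        rwa [sub_add_cancel] at this
      · intro h2
        have := (baryLattice v).sub_mem h2 h1
        rwa [sub_sub_cancel] at this
    rw [hpyr, hwL]
    constructor
    · rintro ⟨h1, h2⟩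
      exact (hiff h1).1 h2
    · intro h1
      have h2 := h a h1
      exact ⟨h2, (hiff h2).2 h1⟩

/-- All vertices except the apex have last coordinate `0`, so the last coordinate of `∑ a i • u i`
is the weight of the apex. -/
theorem IsLatticePyramid.exists_forall_mem_intSubring : ∀ {d : ℕ} {v : Fin (d + 1) → Fin d → ℝ}
    (_ : AffineIndependent ℝ v) (_ : IsLatticePyramid (convexHull ℝ (Set.range v))),
    ∃ i₀, ∀ a ∈ baryLattice v, a i₀ ∈ intSubring := by
  intro d
  cases d with
  | zero => exact fun _ h => h.elim
  | succ d =>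
    rintro v hv ⟨Q, -, hQ⟩
    obtain ⟨U, w, hU, hPQ⟩ := hQ.symm
    have hu := affineIndependent_comp w hU hv
    rw [← baryLattice_comp w hU v]
    rw [image_convexHull_range] at hPQ
    generalize (fun i => integerAffineMap U w (v i)) = u at hu hPQ
    have hcase : ∀ i, u i (Fin.last _) = 0 ∨ u i = Fin.snoc (α := fun _ => ℝ) 0 1 := by
      intro i
      have h1 : u i ∈ (pyramid Q).extremePoints ℝ := by
        rw [hPQ, extremePoints_convexHull_range hu]
        exact ⟨i, rfl⟩
      rcases extremePoints_convexHull_subset h1 with ⟨x, -, hx⟩ | hx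
      · left; rw [← hx]; simp
      · right; exact hx
    have hap : (Fin.snoc (α := fun _ => ℝ) 0 1 : Fin (d + 1) → ℝ) ∈ convexHull ℝ (Set.range u) := by
      rw [← hPQ]
      exact subset_convexHull ℝ _ (Or.inr rfl)
    have hex : ∃ i, u i = Fin.snoc (α := fun _ => ℝ) 0 1 := by
      by_contra! hne
      obtain ⟨a, -, -, ha⟩ := (mem_convexHull_range_iff _ _).1 hap
      have h1 := congrFun ha (Fin.last _)
      rw [Finset.sum_apply, Finset.sum_eq_zero fun i _ => by
        rw [Pi.smul_apply, (hcase i).resolve_right (hne i), smul_zero]] at h1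
      simp at h1
    obtain ⟨i₀, hi₀⟩ := hex
    refine ⟨i₀, fun a ha => ?_⟩
    have h1 := ha.2 (Fin.last _)
    rw [Finset.sum_apply, Finset.sum_eq_single i₀] at h1
    · rw [Pi.smul_apply, hi₀] at h1
      simpa using h1
    · intro j _ hj
      rw [Pi.smul_apply, (hcase j).resolve_right, smul_zero]
      exact fun h => hj (hu.injective (h.trans hi₀.symm))
    · simp

end LatticePolytope

/-! ### The Gorenstein property. -/

namespace LatticePolytope

variable {d : ℕ}

theorem integerAffineMap_one (x : Fin d → ℝ) (w : Fin d → ℤ) :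
    integerAffineMap 1 w x = x + fun c => (w c : ℝ) := by
  have : (1 : Matrix (Fin d) (Fin d) ℤ).map (Int.cast : ℤ → ℝ) = 1 :=
    Matrix.map_one _ Int.cast_zero Int.cast_one
  rw [integerAffineMap, this, Matrix.vecMul_one]

/-- Let `lam x` be the weights of sum zero that represent `x`. The translated simplex is cut out by
`-(m i * lam x i) ≤ 1`, so its dual is spanned by these functionals `u i`, and they are integral
because `m i` clears denominators on the lattice. -/
theorem reflexive_translate {v : Fin (d + 1) → Fin d → ℝ} (hv : AffineIndependent ℝ v)
    (hvi : ∀ j, v j ∈ integerPoints d) {m : Fin (d + 1) → ℕ} (hm : ∀ i, 1 ≤ m i) {a₀ : Fin (d + 1) → ℝ}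
    (ha₀ : ∀ i, m i * a₀ i = 1) (hmem : a₀ ∈ baryLattice v)
    (hint : ∀ a ∈ baryLattice v, ∀ i, m i * a i ∈ intSubring) {r : ℕ} (hr : 1 ≤ r)
    (hrs : ∑ i, a₀ i = r) :
    IsReflexive (convexHull ℝ (Set.range fun i => (r : ℝ) • v i - ∑ j, a₀ j • v j)) := by
  have hr' : (0 : ℝ) < r := by positivity
  have hmp : ∀ i, (0 : ℝ) < m i := fun i => by have := hm i; positivity
  have ha₀p : ∀ i, 0 < a₀ i := fun i =>
    pos_of_mul_pos_right (by rw [ha₀ i]; exact one_pos) (hmp i).le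
  set w := ∑ j, a₀ j • v j with hw
  set q : Fin (d + 1) → Fin d → ℝ := fun i => (r : ℝ) • v i - w with hq
  have hqi : ∀ i, q i ∈ integerPoints d := fun i => by
    rw [mem_integerPoints]
    exact fun c => intSubring.sub_mem (intSubring.mul_mem (natCast_mem _ _)
      (mem_integerPoints.1 (hvi i) c)) (hmem.2 c)
  let lam : (Fin d → ℝ) →ₗ[ℝ] (Fin (d + 1) → ℝ) :=
    (baryEquiv hv).symm.toLinearMap ∘ₗ LinearMap.inl ℝ _ _
  have hlam : ∀ x, ∑ i, lam x i • v i = x ∧ ∑ i, lam x i = 0 := fun x => by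
    have h1 := (baryEquiv hv).apply_symm_apply (x, 0)
    rw [baryEquiv_apply, Prod.ext_iff] at h1
    exact h1
  have hlam_eq : ∀ x b, ∑ i, b i • v i = x → ∑ i, b i = 0 → lam x = b := fun x b h1 h2 =>
    baryMap_injective hv (by
      rw [baryMap_apply, baryMap_apply, (hlam x).1, (hlam x).2, h1, h2])
  have hqsum : ∀ b : Fin (d + 1) → ℝ, ∑ i, b i • q i = (r : ℝ) • ∑ i, b i • v i - (∑ i, b i) • w := by
    intro b
    simp only [hq, smul_sub, Finset.sum_sub_distrib, Finset.sum_smul, Finset.smul_sum]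
    congr 1
    exact Finset.sum_congr rfl fun i _ => smul_comm _ _ _
  let u : Fin (d + 1) → Fin d → ℝ := fun i c => -(m i * lam (Pi.single c 1) i)
  have hu : ∀ x i, x ⬝ᵥ u i = -(m i * lam x i) := by
    intro x i
    conv_rhs => rw [← Finset.univ_sum_single x, map_sum, Finset.sum_apply]
    rw [dotProduct, Finset.mul_sum, ← Finset.sum_neg_distrib]
    refine Finset.sum_congr rfl fun c _ => ?_
    have h1 : (Pi.single c (x c) : Fin d → ℝ) = x c • Pi.single c 1 := by
      funext c'; simp [Pi.single_apply]
    rw [h1, map_smul]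
    simp only [u, Pi.smul_apply, smul_eq_mul]
    ring
  have hui : ∀ i, u i ∈ integerPoints d := fun i => by
    rw [mem_integerPoints]
    intro c
    refine intSubring.neg_mem (hint _ ⟨?_, fun c' => ?_⟩ i)
    · rw [(hlam _).2]; exact intSubring.zero_mem
    · rw [(hlam _).1, Pi.single_apply]
      split_ifs
      · exact intSubring.one_mem
      · exact intSubring.zero_mem
  have hlow : ∀ x ∈ convexHull ℝ (Set.range q), ∀ i, -a₀ i ≤ lam x i := by
    intro x hx i
    obtain ⟨b, hb0, hb1, hbx⟩ := (mem_convexHull_range_iff _ _).1 hx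
    have h1 : lam x = (r : ℝ) • b - a₀ := by
      refine hlam_eq _ _ ?_ ?_
      · rw [← hbx, hqsum, hb1, one_smul]
        simp only [Pi.sub_apply, Pi.smul_apply, smul_eq_mul, sub_smul, mul_smul,
          Finset.sum_sub_distrib, Finset.smul_sum, hw]
      · simp only [Pi.sub_apply, Pi.smul_apply, smul_eq_mul, Finset.sum_sub_distrib, hrs]
        rw [← Finset.mul_sum, hb1]
        ring
    have h2 : lam x i = r * b i - a₀ i := congrFun h1 i
    have h3 := mul_nonneg hr'.le (hb0 i)
    linarith
  have hup : ∀ x, (∀ i, -a₀ i ≤ lam x i) → x ∈ convexHull ℝ (Set.range q) := by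
    intro x hx
    have h1 : ∑ i, (lam x i + a₀ i) / r = 1 := by
      rw [← Finset.sum_div, Finset.sum_add_distrib, (hlam x).2, hrs, zero_add, div_self hr'.ne']
    refine (mem_convexHull_range_iff _ _).2 ⟨fun i => (lam x i + a₀ i) / r, fun i => ?_, h1, ?_⟩
    · have := hx i
      exact div_nonneg (by linarith) hr'.le
    · rw [hqsum, h1, one_smul, Finset.smul_sum]
      have h2 : ∀ i, (r : ℝ) • ((lam x i + a₀ i) / r) • v i = lam x i • v i + a₀ i • v i := fun i => by
        rw [smul_smul, mul_div_cancel₀ _ hr'.ne', add_smul]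
      simp only [h2, Finset.sum_add_distrib, (hlam x).1, ← hw]
      rw [add_sub_cancel_right]
  refine ⟨⟨_, Set.finite_range q, Set.range_nonempty q, by rintro _ ⟨i, rfl⟩; exact hqi i, rfl⟩, ?_,
    ⟨_, Set.finite_range u, Set.range_nonempty u, by rintro _ ⟨i, rfl⟩; exact hui i, ?_⟩⟩
  · have hcont : Continuous lam := lam.continuous_of_finiteDimensional
    refine mem_interior.2 ⟨{x | ∀ i, -a₀ i < lam x i}, fun x hx => hup x fun i => (hx i).le, ?_, ?_⟩
    · simp only [Set.ofPred_forall]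
      exact isOpen_iInter_of_finite fun i =>
        isOpen_lt continuous_const ((continuous_apply i).comp hcont)
    · intro i
      have := ha₀p i
      simpa using this
  · ext y
    constructor
    · intro hy
      have hqy : ∀ i, q i ⬝ᵥ y ≤ 1 := fun i => hy _ (subset_convexHull ℝ _ ⟨i, rfl⟩)
      have hbal : ∀ b : Fin (d + 1) → ℝ, ∑ i, b i * (q i ⬝ᵥ y) = (∑ i, b i • q i) ⬝ᵥ y := fun b => by
        rw [sum_dotProduct]
        simp
      -- The weights are proportional to the slacks `1 - q i ⬝ᵥ y`; they sum to `1` because `∑ a₀ i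
      -- • q i = 0`.
      refine (mem_convexHull_range_iff _ _).2
        ⟨fun i => a₀ i * (1 - q i ⬝ᵥ y) / r, fun i => ?_, ?_, ?_⟩
      · have := hqy i
        exact div_nonneg (mul_nonneg (ha₀p i).le (by linarith)) hr'.le
      · rw [← Finset.sum_div]
        simp only [mul_sub, mul_one, Finset.sum_sub_distrib]
        rw [hbal, hqsum, hrs, ← hw, sub_self, zero_dotProduct, sub_zero, div_self hr'.ne']
      · funext c
        have h1 : ∑ i, lam (Pi.single c 1) i * (q i ⬝ᵥ y) = r * y c := by
          rw [hbal, hqsum, (hlam _).1, (hlam _).2, zero_smul, sub_zero, smul_dotProduct]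
          simp
        have h2 : ∀ i, (a₀ i * (1 - q i ⬝ᵥ y) / r) * u i c =
            (lam (Pi.single c 1) i * (q i ⬝ᵥ y) - lam (Pi.single c 1) i) / r := fun i => by
          have : (a₀ i * (1 - q i ⬝ᵥ y) / r) * u i c =
              (m i * a₀ i) * (lam (Pi.single c 1) i * (q i ⬝ᵥ y) - lam (Pi.single c 1) i) / r := by
            simp only [u]; ring
          rw [this, ha₀ i, one_mul]
        rw [Finset.sum_apply]
        simp only [Pi.smul_apply, smul_eq_mul, h2]
        rw [← Finset.sum_div, Finset.sum_sub_distrib, h1, (hlam _).2, sub_zero,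
          mul_div_cancel_left₀ _ hr'.ne']
    · intro hy x hx
      obtain ⟨t, ht0, ht1, rfl⟩ := (mem_convexHull_range_iff _ _).1 hy
      rw [dotProduct_sum, ← ht1]
      refine Finset.sum_le_sum fun i _ => ?_
      rw [dotProduct_smul, hu, smul_eq_mul]
      have h1 := mul_le_mul_of_nonneg_left (hlow x hx i) (hmp i).le
      have h2 := ha₀ i
      have h3 : -(m i * lam x i) ≤ 1 := by linarith
      nlinarith [mul_le_mul_of_nonneg_left h3 (ht0 i)]

theorem isGorenstein_of_mem_baryLattice {v : Fin (d + 1) → Fin d → ℝ} (hv : AffineIndependent ℝ v)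
    (hvi : ∀ j, v j ∈ integerPoints d) {m : Fin (d + 1) → ℕ} (hm : ∀ i, 1 ≤ m i) {a₀ : Fin (d + 1) → ℝ}
    (ha₀ : ∀ i, m i * a₀ i = 1) (hmem : a₀ ∈ baryLattice v)
    (hint : ∀ a ∈ baryLattice v, ∀ i, m i * a i ∈ intSubring) :
    IsGorenstein (convexHull ℝ (Set.range v)) := by
  have ha₀p : ∀ i, 0 < a₀ i := fun i =>
    pos_of_mul_pos_right (by rw [ha₀ i]; exact one_pos) (Nat.cast_nonneg (m i))
  obtain ⟨r, hr⟩ := exists_height (fun i => (ha₀p i).le) hmem.1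
  have hr1 : 1 ≤ r := by
    have : (0 : ℝ) < r := by
      rw [← hr]; exact Finset.sum_pos (fun i _ => ha₀p i) Finset.univ_nonempty
    exact_mod_cast this
  obtain ⟨w, hw⟩ := mem_integerPoints.2 hmem.2
  refine ⟨r, hr1, _, reflexive_translate hv hvi hm ha₀ hmem hint hr1 hr, 1, -w, by simp, ?_⟩
  have h1 : (r : ℝ) • convexHull ℝ (Set.range v) =
      convexHull ℝ (Set.range fun i => (r : ℝ) • v i) := by
    rw [← convexHull_smul]
    congr 1
    ext x
    simp [Set.mem_smul_set]
  rw [h1, image_convexHull_range]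
  congr 2
  funext i
  rw [integerAffineMap_one, ← hw]
  funext c
  simp [sub_eq_add_neg]

/-- The values `1 / m j` satisfy the congruences because `m j = n j * m (par j)`; at a root the
parent value `1 / m s = 1` is replaced by the congruent `0`. -/
theorem IsBalanced.isGorenstein {s k : ℕ} {n par : ℕ → ℕ} {e : Fin (d + 1) → ℕ}
    (h : IsBalanced s n par e k) (he : ∀ i, e i < s) {v : Fin (d + 1) → Fin d → ℝ}
    (hv : AffineIndependent ℝ v) (hvi : ∀ j, v j ∈ integerPoints d)
    (hL : baryLattice v = forestLattice s n par e) : IsGorenstein (convexHull ℝ (Set.range v)) := by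
  obtain ⟨m, hm0, hm, hm1, hm2, hmx⟩ := h.forest.exists_degree
  have hmne : ∀ j ≤ s, (m j : ℝ) ≠ 0 := fun j hj => by have := hm1 j hj; positivity
  refine isGorenstein_of_mem_baryLattice hv hvi (m := fun i => m (e i)) (a₀ := fun i => 1 / m (e i))
    (fun i => hm1 _ (h.label_le i)) (fun i => mul_one_div_cancel (hmne _ (h.label_le i))) ?_ ?_
  · rw [hL]
    refine ⟨fun j => if j < s then 1 / m j else 0, by simp, fun j hj => ?_, fun i => ?_⟩
    · have hn := h.forest.two_le j hj
      have hn' : (n j : ℝ) ≠ 0 := by positivity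
      have hp := hmne _ (h.forest.par_le j hj)
      have h1 : (n j : ℝ) * (1 / m j) = 1 / m (par j) := by
        rw [hm j hj]; push_cast; field_simp
      simp only [defect, if_pos hj, h1]
      rcases (h.forest.par_le j hj).lt_or_eq with hlt | heq
      · rw [if_pos hlt, sub_self]; exact intSubring.zero_mem
      · rw [if_neg (by omega), heq, hm0]; simp
    · simp [he i]
  · intro a ha i
    rw [hL] at ha
    obtain ⟨x, hx0, hxd, hxa⟩ := ha
    have := intSubring.add_mem (intSubring.mul_mem (natCast_mem intSubring (m (e i))) (hxa i))
      (hmx x hx0 hxd _ (h.label_le i))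
    convert this using 1
    ring

end LatticePolytope

/-! ### The bijection between classes and forests. -/

namespace LatticePolytope

theorem IsBalanced.congr {ι : Type*} [Fintype ι] {s k : ℕ} {n par n' par' : ℕ → ℕ} {e : ι → ℕ}
    (h : IsBalanced s n par e k) (hn : ∀ j < s, n j = n' j ∧ par j = par' j) :
    IsBalanced s n' par' e k := by
  refine ⟨⟨fun j hj => ?_, fun j hj => ?_, fun j hj => ?_⟩, h.label_le, fun x hx => ?_⟩
  · rw [← (hn j hj).1]; exact h.forest.two_le j hj
  · rw [← (hn j hj).2]; exact h.forest.lt_par j hj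
  · rw [← (hn j hj).2]; exact h.forest.par_le j hj
  · rw [h.sum_eq x hx]
    congr 1
    refine Finset.sum_congr rfl fun j hj => ?_
    rw [Finset.mem_range] at hj
    rw [placeValue_congr (j := j) fun i hi => (hn i (by omega)).1, defect, defect, (hn j hj).1,
      (hn j hj).2]

theorem HasBlockHeights.finite_unitBox {ι : Type*} [Fintype ι] {L : AddSubgroup (ι → ℝ)} {v k : ℕ}
    (h : HasBlockHeights L v k) : (unitBox L).Finite := by
  choose M hM hMs using h.2
  refine Finite.of_injective (fun a : unitBox L => (⟨M a a.2, hM a a.2⟩ : Fin v))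
    fun a b hab => Subtype.ext ?_
  have hab' : M a a.2 = M b b.2 := congrArg Fin.val hab
  exact (h.1 _ (hM a a.2)).unique ⟨a.2, hMs a a.2⟩ ⟨b.2, by rw [hMs b b.2, hab']⟩

/-- A weighted forest with weight product `v`: the number of nodes, their weights and their
parents, where the value `size` stands for "no parent". -/
structure ForestDatum (v : ℕ) where
  /-- The number of nodes. -/
  size : ℕ
  /-- The weights of the nodes. -/
  weights : {n : Fin size → ℕ // (∀ j, 2 ≤ n j) ∧ ∏ j, n j = v}
  /-- The parents of the nodes. -/
  parents : ∀ j : Fin size, {c : ℕ // j < c ∧ c ≤ size}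

/-- Extension of a function on `Fin s` by zero. -/
def extendNat {s : ℕ} (f : Fin s → ℕ) (j : ℕ) : ℕ := if h : j < s then f ⟨j, h⟩ else 0

theorem extendNat_of_lt {s : ℕ} (f : Fin s → ℕ) {j : ℕ} (h : j < s) : extendNat f j = f ⟨j, h⟩ :=
  dif_pos h

namespace ForestDatum

variable {v : ℕ}

/-- The weights of a forest, extended by zero. -/
def weight (D : ForestDatum v) : ℕ → ℕ := extendNat D.weights.1

/-- The parents in a forest, extended by zero. -/
def parent (D : ForestDatum v) : ℕ → ℕ := extendNat fun j => (D.parents j).1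

theorem weight_of_lt (D : ForestDatum v) {j : ℕ} (hj : j < D.size) :
    D.weight j = D.weights.1 ⟨j, hj⟩ := extendNat_of_lt _ hj

theorem parent_of_lt (D : ForestDatum v) {j : ℕ} (hj : j < D.size) :
    D.parent j = (D.parents ⟨j, hj⟩).1 := extendNat_of_lt _ hj

theorem isForest (D : ForestDatum v) : IsForest D.size D.weight D.parent where
  two_le j hj := by rw [D.weight_of_lt hj]; exact D.weights.2.1 _
  lt_par j hj := by rw [D.parent_of_lt hj]; exact (D.parents ⟨j, hj⟩).2.1
  par_le j hj := by rw [D.parent_of_lt hj]; exact (D.parents ⟨j, hj⟩).2.2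

theorem placeValue_weight (D : ForestDatum v) : placeValue D.weight D.size = v := by
  rw [placeValue, Finset.prod_range]
  exact (Finset.prod_congr rfl fun j _ => D.weight_of_lt j.2).trans D.weights.2.2

theorem exists_datum {s : ℕ} {n par : ℕ → ℕ} (h : IsForest s n par) (hv : placeValue n s = v) :
    ∃ D : ForestDatum v, D.size = s ∧ ∀ j < s, n j = D.weight j ∧ par j = D.parent j := by
  let D : ForestDatum v := ⟨s, ⟨fun j => n j, fun j => h.two_le j j.2, by
    rw [← hv, placeValue, Finset.prod_range]⟩, fun j => ⟨par j, h.lt_par j j.2, h.par_le j j.2⟩⟩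
  exact ⟨D, rfl, fun j hj => ⟨(D.weight_of_lt hj).symm, (D.parent_of_lt hj).symm⟩⟩

theorem ext {D D' : ForestDatum v} (hs : D.size = D'.size)
    (h : ∀ j < D.size, D.weight j = D'.weight j ∧ D.parent j = D'.parent j) : D = D' := by
  obtain ⟨s, n, par⟩ := D
  obtain ⟨s', n', par'⟩ := D'
  obtain rfl : s = s' := hs
  have h1 : n = n' := Subtype.ext (funext fun j => by
    have := (h j j.2).1
    rwa [weight_of_lt _ j.2, weight_of_lt _ j.2] at this)
  have h2 : par = par' := funext fun j => Subtype.ext (by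
    have := (h j j.2).2
    rwa [parent_of_lt _ j.2, parent_of_lt _ j.2] at this)
  rw [h1, h2]

/-- `P` is a lattice simplex whose lattice of barycentric coordinates is that of the forest `D`. -/
def Represents (D : ForestDatum v) (k : ℕ) {d : ℕ} (P : Set (Fin d → ℝ)) : Prop :=
  ∃ (x : Fin (d + 1) → Fin d → ℝ) (e : Fin (d + 1) → ℕ), (∀ j, x j ∈ integerPoints d) ∧
    AffineIndependent ℝ x ∧ P = convexHull ℝ (Set.range x) ∧
    IsBalanced D.size D.weight D.parent e k ∧ (∀ i, e i < D.size) ∧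
    baryLattice x = forestLattice D.size D.weight D.parent e

theorem mem_forestLattice_comp {ι ι' : Type*} (E : ι ≃ ι') {s : ℕ} {n par : ℕ → ℕ} (e : ι' → ℕ)
    (a : ι → ℝ) : a ∘ E.symm ∈ forestLattice s n par e ↔ a ∈ forestLattice s n par (e ∘ E) := by
  rw [mem_forestLattice, mem_forestLattice]
  refine exists_congr fun x => and_congr_right fun _ => and_congr_right fun _ => ?_
  rw [← E.forall_congr_right]
  simp

theorem baryLattice_comp_equiv {d : ℕ} {x : Fin (d + 1) → Fin d → ℝ} {s : ℕ} {n par : ℕ → ℕ}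
    {e : Fin (d + 1) → ℕ} (h : baryLattice x = forestLattice s n par e)
    (E : Fin (d + 1) ≃ Fin (d + 1)) : baryLattice (x ∘ E) = forestLattice s n par (e ∘ E) := by
  ext a
  rw [mem_baryLattice_comp_equiv, h, mem_forestLattice_comp]

theorem exists_represents {v k d : ℕ} (hv : 2 ≤ v) (hk : 1 ≤ k) (P : GorensteinSimplex v k d) :
    ∃ D : ForestDatum v, D.Represents k P.1 := by
  obtain ⟨P, ⟨x, hxi, hx, rfl⟩, -, hpyr, hh⟩ := P
  rw [hasHStarPolynomial_blockPolynomial_iff hx hxi hk] at hh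
  obtain ⟨s, n, par, e, hb, hN, hL⟩ :=
    hh.exists_isBalanced hk fun a => intSubring_mem_baryLattice hxi
  obtain ⟨D, rfl, hD⟩ := exists_datum hb.forest hN
  refine ⟨D, x, e, hxi, hx, rfl, hb.congr hD, fun i => hb.label_lt ?_,
    by rw [hL, forestLattice_congr e hD]⟩
  rw [← hL]
  by_contra! hint
  cases d with
  | zero =>
    -- In dimension `0` no simplex counts as a pyramid. There the only coordinate equals the sum and
    -- is integral, so no box element of height `k` exists.
    obtain ⟨a, ⟨ha, has⟩, -⟩ := hh.1 1 (by omega)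
    have h0 : a 0 ∈ intSubring := by simpa using ha.1.1
    have h1 := eq_zero_of_mem_intSubring h0 (by linarith [(ha.2 0).1]) (ha.2 0).2
    have hk' : (k : ℝ) ≠ 0 := by positivity
    simp [h1] at has
    exact hk' has.symm
  | succ d => exact hpyr (isLatticePyramid_of_forall_mem_intSubring hx hxi hint)

theorem exists_gorensteinSimplex {v k : ℕ} (hv : 2 ≤ v) (hk : 1 ≤ k) (D : ForestDatum v) :
    ∃ (d : ℕ) (P : GorensteinSimplex v k d), D.Represents k P.1 := by
  have hs : 1 ≤ D.size := by
    by_contra! h0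
    have h1 := D.placeValue_weight
    rw [show D.size = 0 by omega, placeValue_zero] at h1
    omega
  obtain ⟨d, e, hb, he⟩ := D.isForest.exists_isBalanced hs hk
  have hH := hb.hasBlockHeights hk
  have hZ : ∀ a : Fin (d + 1) → ℝ, (∀ i, a i ∈ intSubring) →
      a ∈ forestLattice D.size D.weight D.parent e := fun a => intSubring_mem_forestLattice
  obtain ⟨N, hN, hLN⟩ := exists_mul_mem_intSubring hZ hH.finite_unitBox
  obtain ⟨x, hxi, hx, hL⟩ := exists_baryLattice_eq hZ hN hLN (by
    rintro a ⟨y, hy0, hyd, hya⟩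
    have h1 : ∑ i, y (e i) ∈ intSubring := by
      rw [hb.sum_eq y hy0]
      exact intSubring.mul_mem (natCast_mem _ _) (intSubring.sum_mem fun j hj =>
        intSubring.mul_mem (natCast_mem _ _) (hyd j (Finset.mem_range.1 hj)))
    have h2 := intSubring.add_mem (intSubring.sum_mem fun i (_ : i ∈ Finset.univ) => hya i) h1
    rwa [Finset.sum_sub_distrib, sub_add_cancel] at h2)
  refine ⟨d, ⟨convexHull ℝ (Set.range x), ⟨x, hxi, hx, rfl⟩, hb.isGorenstein he hx hxi hL,
    fun hpyr => ?_, ?_⟩, x, e, hxi, hx, rfl, hb, he, hL⟩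
  · obtain ⟨i, hi⟩ := hpyr.exists_forall_mem_intSubring hx
    obtain ⟨a, ha, hai⟩ := hb.exists_not_mem_intSubring (he i)
    exact hai (hi a (hL ▸ ha))
  · rw [hasHStarPolynomial_blockPolynomial_iff hx hxi hk, hL]
    rwa [D.placeValue_weight] at hH

/-- The forest fixes the total number of labels, hence the dimension; classes from all dimensions
can therefore be counted together. -/
theorem Represents.dim_eq {k d d' : ℕ} {D : ForestDatum v} {P : Set (Fin d → ℝ)}
    {Q : Set (Fin d' → ℝ)} (hP : D.Represents k P) (hQ : D.Represents k Q) : d = d' := by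
  obtain ⟨x, e, -, -, -, hb, he, -⟩ := hP
  obtain ⟨x', e', -, -, -, hb', he', -⟩ := hQ
  obtain ⟨E, -⟩ := hb.exists_perm hb' (fun j _ => ⟨rfl, rfl⟩) he he'
  simpa using Fintype.card_congr E

theorem Represents.unimodularlyEquivalent {k d : ℕ} {D : ForestDatum v} {P Q : Set (Fin d → ℝ)}
    (hP : D.Represents k P) (hQ : D.Represents k Q) : UnimodularlyEquivalent P Q := by
  obtain ⟨x, e, -, hx, rfl, hb, he, hL⟩ := hP
  obtain ⟨x', e', -, hx', rfl, hb', he', hL'⟩ := hQ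
  obtain ⟨E, hE⟩ := hb.exists_perm hb' (fun j _ => ⟨rfl, rfl⟩) he he'
  rw [← E.surjective.range_comp x']
  refine unimodularlyEquivalent_of_baryLattice_eq hx (hx'.comp_embedding E.toEmbedding) ?_
  have he'' : e' ∘ E = e := funext hE
  have h1 := baryLattice_comp_equiv hL' E
  rw [he'', ← hL] at h1
  exact h1.symm

/-- An equivalence matches vertices with vertices, so the lattices agree after permuting
coordinates, and the lattice determines the forest. -/
theorem Represents.eq {k d : ℕ} (hk : 1 ≤ k) {D D' : ForestDatum v} {P Q : Set (Fin d → ℝ)}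
    (hP : D.Represents k P) (hQ : D'.Represents k Q) (h : UnimodularlyEquivalent P Q) : D = D' := by
  obtain ⟨x, e, -, hx, rfl, hb, he, hL⟩ := hP
  obtain ⟨x', e', -, hx', rfl, hb', he', hL'⟩ := hQ
  obtain ⟨U, w, hU, hPQ⟩ := h
  rw [image_convexHull_range] at hPQ
  obtain ⟨E, hE⟩ := exists_perm_of_convexHull_eq hx' (affineIndependent_comp w hU hx) hPQ
  have h1 := baryLattice_comp_equiv hL' E
  have h2 : x' ∘ E = fun i => integerAffineMap U w (x i) := funext hE
  rw [h2, baryLattice_comp w hU, hL] at h1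
  have hb'' : IsBalanced D'.size D'.weight D'.parent (e' ∘ E) k :=
    ⟨hb'.forest, fun i => hb'.label_le _, fun y hy => by
      rw [← hb'.sum_eq y hy]
      exact E.sum_comp fun i => y (e' i)⟩
  obtain ⟨hs, hn⟩ := hb.unique hb'' hk (by rw [D.placeValue_weight, D'.placeValue_weight]) h1
  exact ForestDatum.ext hs hn

end ForestDatum

theorem numClasses_eq_card_forestDatum {v k : ℕ} (hv : 2 ≤ v) (hk : 1 ≤ k) :
    numClasses v k = ENat.card (ForestDatum v) := by
  choose f hf using fun c : Σ d : ℕ, Quotient (gorensteinSimplexSetoid v k d) =>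
    ForestDatum.exists_represents hv hk c.2.out
  refine ENat.card_congr (Equiv.ofBijective f ⟨?_, fun D => ?_⟩)
  · rintro ⟨d, P⟩ ⟨d', Q⟩ heq
    have hP := hf ⟨d, P⟩
    have hQ := hf ⟨d', Q⟩
    rw [heq] at hP
    obtain rfl : d = d' := hP.dim_eq hQ
    have h1 : (gorensteinSimplexSetoid v k d).r P.out Q.out := hP.unimodularlyEquivalent hQ
    have h2 : P = Q := by
      rw [← Quotient.out_eq P, ← Quotient.out_eq Q]
      exact Quotient.sound h1
    rw [h2]
  · obtain ⟨d, P, hP⟩ := D.exists_gorensteinSimplex hv hk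
    refine ⟨⟨d, Quotient.mk _ P⟩, (hf _).eq hk hP ?_⟩
    exact Quotient.mk_out (s := gorensteinSimplexSetoid v k d) P

end LatticePolytope

/-! ### Counting forests for a prime power. -/

namespace LatticePolytope

/-- Ordered factorizations of `p ^ l` into `s` factors larger than `1` correspond to
compositions of `l` with `s` parts. -/
theorem card_orderedFactorization {p l s : ℕ} (hp : p.Prime) (hs : 1 ≤ s) (hsl : s ≤ l) :
    Nat.card {n : Fin s → ℕ // (∀ j, 2 ≤ n j) ∧ ∏ j, n j = p ^ l} = (l - 1).choose (s - 1) := by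
  have hprod : ∀ a : Fin s → ℕ, ∏ j, p ^ (a j + 1) = p ^ (∑ j, a j + s) := fun a => by
    rw [Finset.prod_pow_eq_pow_sum, Finset.sum_add_distrib]
    simp
  -- All factors are powers of `p` with positive exponents; lowering each exponent by one leaves a
  -- vector of natural numbers with sum `l - s`.
  let f : (Finset.univ : Finset (Fin s)).finsuppAntidiag (l - s) →
      {n : Fin s → ℕ // (∀ j, 2 ≤ n j) ∧ ∏ j, n j = p ^ l} := fun a =>
    ⟨fun j => p ^ (a.1 j + 1), fun j => hp.two_le.trans (Nat.le_self_pow (by omega) p), by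
      have h1 : ∑ j, a.1 j = l - s := (Finset.mem_finsuppAntidiag.1 a.2).1
      rw [hprod, h1, Nat.sub_add_cancel hsl]⟩
  have hf : Function.Bijective f := by
    constructor
    · intro a b hab
      ext j
      have h1 : p ^ (a.1 j + 1) = p ^ (b.1 j + 1) := congrFun (congrArg Subtype.val hab) j
      have := Nat.pow_right_injective hp.two_le h1
      omega
    · rintro ⟨n, hn, hprod'⟩
      have h1 : ∀ j, ∃ t, n j = p ^ (t + 1) := fun j => by
        obtain ⟨t, -, ht⟩ := (Nat.dvd_prime_pow hp).1
          (hprod' ▸ Finset.dvd_prod_of_mem n (Finset.mem_univ j))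
        have h2 := hn j
        cases t with
        | zero => rw [ht] at h2; simp at h2
        | succ t => exact ⟨t, ht⟩
      choose t ht using h1
      refine ⟨⟨Finsupp.equivFunOnFinite.symm t, ?_⟩, ?_⟩
      · have h2 : p ^ (∑ j, t j + s) = p ^ l := by
          rw [← hprod, ← hprod']
          exact Finset.prod_congr rfl fun j _ => (ht j).symm
        have h3 := Nat.pow_right_injective hp.two_le h2
        rw [Finset.mem_finsuppAntidiag]
        refine ⟨?_, by simp⟩
        simp only [Finsupp.equivFunOnFinite_symm_apply_apply]
        omega
      · exact Subtype.ext (funext fun j => (ht j).symm)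
  rw [← Nat.card_eq_of_bijective f hf, Nat.card_eq_fintype_card, Fintype.card_coe,
    Finset.card_finsuppAntidiag_nat_eq_choose, Finset.card_univ, Fintype.card_fin,
    show s + (l - s) - 1 = l - 1 by omega, ← Nat.choose_symm (by omega : s - 1 ≤ l - 1)]
  congr 1
  omega

/-- Node `j` has the `s - j` choices `j + 1, …, s`. -/
theorem card_parents (s : ℕ) : Nat.card (∀ j : Fin s, {c : ℕ // j < c ∧ c ≤ s}) = s.factorial := by
  rw [Nat.card_pi, ← Nat.descFactorial_self, Nat.descFactorial_eq_prod_range, Finset.prod_range]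
  refine Finset.prod_congr rfl fun j _ => ?_
  rw [← Nat.card_Ioc, ← Fintype.card_coe, ← Nat.card_eq_fintype_card]
  exact Nat.card_congr (Equiv.subtypeEquivRight fun c => Finset.mem_Ioc.symm)

theorem card_forestDatum_prime_pow {p l : ℕ} (hp : p.Prime) (hl : 1 ≤ l) :
    ENat.card (ForestDatum (p ^ l)) =
      ((∑ s ∈ Finset.Icc 1 l, (l - 1).choose (s - 1) * s.factorial : ℕ) : ℕ∞) := by
  have hs : ∀ D : ForestDatum (p ^ l), D.size ∈ Finset.Icc 1 l := fun D => by
    have h1 := D.placeValue_weight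
    have h2 := two_pow_le_placeValue D.isForest.two_le
    have hone : 1 < p ^ l := Nat.one_lt_pow (by omega) hp.one_lt
    rw [Finset.mem_Icc]
    constructor
    · by_contra! h0
      rw [show D.size = 0 by omega, placeValue_zero] at h1
      omega
    · have h3 : p ^ D.size ≤ p ^ l := by
        refine le_of_le_of_eq ?_ h1
        rw [placeValue]
        have : ∀ j ∈ Finset.range D.size, p ≤ D.weight j := fun j hj => by
          have hdvd : D.weight j ∣ p ^ l :=
            (Finset.dvd_prod_of_mem D.weight hj).trans h1.dvd
          obtain ⟨t, -, ht⟩ := (Nat.dvd_prime_pow hp).1 hdvd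
          have h4 := D.isForest.two_le j (Finset.mem_range.1 hj)
          rw [ht] at h4 ⊢
          refine Nat.le_self_pow ?_ p
          rintro rfl
          simp at h4
        simpa using Finset.prod_le_prod' this
      exact (Nat.pow_le_pow_iff_right hp.one_lt).1 h3
  let e : ForestDatum (p ^ l) ≃ Σ s : Finset.Icc 1 l,
      {n : Fin s.1 → ℕ // (∀ j, 2 ≤ n j) ∧ ∏ j, n j = p ^ l} ×
        ∀ j : Fin s.1, {c : ℕ // j < c ∧ c ≤ s.1} :=
    { toFun := fun D => ⟨⟨D.size, hs D⟩, D.weights, D.parents⟩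
      invFun := fun D => ⟨D.1.1, D.2.1, D.2.2⟩
      left_inv := fun D => rfl
      right_inv := fun D => rfl }
  have hcard : ∀ s : Finset.Icc 1 l, Nat.card ({n : Fin s.1 → ℕ // (∀ j, 2 ≤ n j) ∧
      ∏ j, n j = p ^ l} × ∀ j : Fin s.1, {c : ℕ // j < c ∧ c ≤ s.1}) =
        (l - 1).choose (s.1 - 1) * s.1.factorial := fun s => by
    have := Finset.mem_Icc.1 s.2
    rw [Nat.card_prod, card_orderedFactorization hp this.1 this.2, card_parents]
  have hfin : ∀ s : Finset.Icc 1 l, Finite ({n : Fin s.1 → ℕ // (∀ j, 2 ≤ n j) ∧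
      ∏ j, n j = p ^ l} × ∀ j : Fin s.1, {c : ℕ // j < c ∧ c ≤ s.1}) := fun s => by
    -- `Nat.card` is `0` on infinite types, so a positive value proves finiteness.
    refine Nat.finite_of_card_ne_zero ?_
    have := Finset.mem_Icc.1 s.2
    rw [hcard]
    exact (Nat.mul_pos (Nat.choose_pos (by omega)) (Nat.factorial_pos _)).ne'
  rw [ENat.card_congr e, ENat.card_eq_coe_natCard, Nat.card_sigma]
  simp only [hcard]
  rw [Finset.sum_coe_sort (Finset.Icc 1 l) fun s => (l - 1).choose (s - 1) * s.factorial]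

end LatticePolytope

theorem mainTheorem8 (p l k : ℕ) (hp : p.Prime) (hl : 1 ≤ l) (hk : 1 ≤ k) :
    LatticePolytope.numClasses (p ^ l) k =
      ((∑ s ∈ Finset.Icc 1 l, (l - 1).choose (s - 1) * s.factorial : ℕ) : ℕ∞) := by
  rw [LatticePolytope.numClasses_eq_card_forestDatum (Nat.one_lt_pow (by omega) hp.one_lt) hk,
    LatticePolytope.card_forestDatum_prime_pow hp hl]
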